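/- Let $M$ and $N$ be complex manifolds of dimensions $m=\dim_{\mathbb C}M\ge 1$ and $n=\dim_{\mathbb C}N$, with $m\le n$ and $M$ compact, let $g$ and $h$ be (smooth) Hermitian metrics on $M$ and $N$, and let $f\colon M\to N$ be a holomorphic map. **Curvature.** For a Hermitian metric $g$ on $M$, in local holomorphic coordinates, the Chern curvature tensor is $$R_{i\bar jk\bar l}=-\frac{\partial^2 g_{k\bar l}}{\partial z^i\partial\bar z^j}+\sum_{p,q}g^{p\bar q}\frac{\partial g_{k\bar q}}{\partial z^i}\frac{\partial g_{p\bar l}}{\partial\bar z^j},$$ and the Chern scalar curvature is $S=\sum g^{i\bar j}g^{k\bar l}R_{i\bar jk\bar l}$. For an $\ell$-dimensional subspace $\Sigma\subset T'_pM$ with unitary basis $E_1,\dots,E_\ell$ and $v\in\Sigma$ put $$Ric^{(1)}_\ell(p,\Sigma)(v,\bar v)=\sum_{i=1}^{\ell}R(v,\bar v,E_i,\overline{E_i}),\qquad Ric^{(2)}_\ell(p,\Sigma)(v,\bar v)=\sum_{i=1}^{\ell}R(E_i,\overline{E_i},v,\bar v),$$ $$S_\ell(p,\Sigma)=\sum_{i,j=1}^{\ell}R(E_i,\overline{E_i},E_j,\overline{E_j}).$$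 For a real constant $c$, "$Ric_\ell^{(1)}\le c$" means $Ric^{(1)}_\ell(p,\Sigma)(v,\bar v)\le c|v|^2$ for all points $p$, all $\ell$-dimensional $\Sigma\subset T'_p$ and all $v\in\Sigma$; similarly for "$Ric_\ell^{(2)}\ge c$"; "$S_\ell\ge c$" means $S_\ell(p,\Sigma)\ge c$ for all $p$ and $\Sigma$. The real bisectional curvature satisfies $\widetilde B\le c$ if $\widetilde B(e,a)=|a|^{-2}\sum_{i,j}R(e_i,\overline{e_i},e_j,\overline{e_j})a_ia_j\le c$ for every unitary frame $e$ of the holomorphic tangent space at any point and every tuple $a\neq0$ of nonnegative real numbers $a_i$. The same definitions apply to $(N,h)$. **Quantities attached to $f$.** With $A_{\alpha\bar\beta}$ the components of $f^*h$ in local holomorphic coordinates of $M$, $\frac{(f^*h)^m}{g^m}=\frac{\det(A_{\alpha\bar\beta})}{\det(g_{\alpha\bar\beta})}$. Further, $$\|\wedge^\ell\partial f\|_0(x)=\sup\Big\{\frac{|\partial f(v_1)\wedge\dots\wedge\partial f(v_\ell)|}{|v_1\wedge\dots\wedge v_\ell|} : v_1,\dots,v_\ell\in T'_xM,\ v_1\wedge\dots\wedge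 v_\ell\ne0\Big\},$$ where $|v_1\wedge\dots\wedge v_\ell|^2=\det\big(g(v_i,\overline{v_j})\big)$, and likewise with $h$ on $N$. Finally $\sigma_\ell(x)=\sum_{\alpha=1}^{\ell}|\lambda_\alpha|^2(x)$, where $|\lambda_1|\ge\dots\ge|\lambda_m|$ are the singular values of $\partial f\colon(T'_xM,g)\to(T'_{f(x)}N,h)$. **Theorem.** Let $K\ge0$ and $\kappa>0$ be real numbers. (a) If $S\ge-K$ on $(M,g)$ and $Ric_m^{(1)}\le-\kappa$ on $(N,h)$, then for all $x\in M$ $$\frac{(f^*h)^m}{g^m}(x)\le\Big(\frac{K}{m\kappa}\Big)^m.$$ (b) Let $1\le\ell<m$ and let $g$ be Kähler, i.e. $\omega=\sqrt{-1}\sum g_{i\bar j}\,dz^i\wedge d\bar z^j$ satisfies $d\omega=0$. If $S_\ell\ge-K$ on $(M,g)$ and $Ric_\ell^{(1)}\le-\kappa$ on $(N,h)$, then for all $x\in M$ $$\|\wedge^\ell\partial f\|_0^2(x)\le\Big(\frac{K}{\ell\kappa}\Big)^\ell.$$ (c) Let $1\le\ell\le m$. If $Ric_\ell^{(2)}\ge-K$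 on $(M,g)$ and $\widetilde B\le-\kappa$ on $(N,h)$, then for all $x\in M$ $$\sigma_\ell(x)\le\frac{\ell K}{\kappa}.$$ -/

import Mathlib

open scoped Manifold ContDiff

noncomputable section

namespace HermitianGeometry

/-- The model space `ℂᵐ` of a complex manifold of dimension `m`. -/
abbrev Cn (m : ℕ) : Type := EuclideanSpace ℂ (Fin m)

/-- The holomorphic tangent space `T'ₓM` of a complex manifold `M` of dimension `m`: the tangent
space over `ℂ`, a complex vector space of dimension `m`. -/
abbrev T (m : ℕ) {M : Type*} [TopologicalSpace M] [ChartedSpace (Cn m) M] (x : M) : Type :=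
  TangentSpace 𝓘(ℂ, Cn m) x

/-- The coordinate vector `∂/∂zⁱ` of the chart `φ`, at the point with coordinates `z`. -/
def coordVec {m : ℕ} {M : Type*} [TopologicalSpace M] [ChartedSpace (Cn m) M]
    (φ : OpenPartialHomeomorph M (Cn m)) (z : Cn m) (i : Fin m) : T m (φ.symm z) :=
  mfderiv 𝓘(ℂ, Cn m) 𝓘(ℂ, Cn m) φ.symm z (EuclideanSpace.single i (1 : ℂ) : Cn m)

/-- A (smooth) Hermitian metric on a complex manifold: `inner x u v` is `g(u, v̄)`, linear in `u`
and conjugate linear in `v`. Smoothness (as real functions) is that of the components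
`g_{i j̄}` in all charts. -/
structure HermitianMetric (m : ℕ) (M : Type*) [TopologicalSpace M] [ChartedSpace (Cn m) M] where
  inner : ∀ x : M, T m x →ₗ[ℂ] T m x →ₗ⋆[ℂ] ℂ
  conj_symm : ∀ (x : M) (u v : T m x), starRingEnd ℂ (inner x v u) = inner x u v
  pos : ∀ (x : M) (u : T m x), u ≠ 0 → 0 < (inner x u u).re
  smooth : ∀ φ ∈ atlas (Cn m) M, ∀ i j : Fin m,
    ContDiffOn ℝ ∞ (fun z => inner (φ.symm z) (coordVec φ z i) (coordVec φ z j)) φ.target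

/-- The Wirtinger derivative `∂F/∂zⁱ`. -/
def dz {m : ℕ} (i : Fin m) (F : Cn m → ℂ) (z : Cn m) : ℂ :=
  (1 / 2 : ℂ) * (fderiv ℝ F z (EuclideanSpace.single i (1 : ℂ))
    - Complex.I * fderiv ℝ F z (EuclideanSpace.single i Complex.I))

/-- The Wirtinger derivative `∂F/∂z̄ⁱ`. -/
def dzbar {m : ℕ} (i : Fin m) (F : Cn m → ℂ) (z : Cn m) : ℂ :=
  (1 / 2 : ℂ) * (fderiv ℝ F z (EuclideanSpace.single i (1 : ℂ))
    + Complex.I * fderiv ℝ F z (EuclideanSpace.single i Complex.I))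

/-- The coordinate `zⁱ` on `ℂᵐ` as a real-linear form, that is, the constant 1-form `dzⁱ`. -/
def formDz {m : ℕ} (i : Fin m) : Cn m →L[ℝ] ℂ :=
  (EuclideanSpace.proj i : Cn m →L[ℂ] ℂ).restrictScalars ℝ

/-- The constant 1-form `dz̄ⁱ` on `ℂᵐ`. -/
def formDzbar {m : ℕ} (i : Fin m) : Cn m →L[ℝ] ℂ :=
  (Complex.conjCLE : ℂ →L[ℝ] ℂ).comp (formDz i)

/-- The wedge product `a ∧ b` of two 1-forms: `(a ∧ b)(u, v) = a(u) b(v) - a(v) b(u)`. -/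
def wedge {m : ℕ} (a b : Cn m →L[ℝ] ℂ) : Cn m [⋀^Fin 2]→L[ℝ] ℂ :=
  ContinuousMultilinearMap.alternatization
    ((ContinuousMultilinearMap.mkPiAlgebraFin ℝ 2 ℂ).compContinuousLinearMap ![a, b])

section Metric

variable {m : ℕ} {M : Type*} [TopologicalSpace M] [ChartedSpace (Cn m) M]

/-- The components `(uⁱ)` of a tangent vector `u` at `x`, `u = ∑ uⁱ ∂/∂zⁱ`, in the preferred
chart at `x`. -/
def comp (x : M) (u : T m x) (i : Fin m) : ℂ :=
  (show Cn m from mfderiv 𝓘(ℂ, Cn m) 𝓘(ℂ, Cn m) (chartAt (Cn m) x) x u) i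

namespace HermitianMetric

/-- The matrix `(g_{i j̄})` of the metric in the chart `φ`, at the point with coordinates `z`. -/
def matrix (g : HermitianMetric m M) (φ : OpenPartialHomeomorph M (Cn m)) (z : Cn m) :
    Matrix (Fin m) (Fin m) ℂ :=
  Matrix.of fun i j => g.inner (φ.symm z) (coordVec φ z i) (coordVec φ z j)

/-- The components `g^{i j̄}` of the inverse metric: `∑ⱼ g^{i j̄} g_{k j̄} = δᵢₖ`. -/
def inv (g : HermitianMetric m M) (φ : OpenPartialHomeomorph M (Cn m)) (z : Cn m)
    (i j : Fin m) : ℂ :=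
  (g.matrix φ z)⁻¹ j i

/-- The metric form `ω = √-1 ∑ g_{i j̄} dzⁱ ∧ dz̄ʲ` in the chart `φ`. -/
def metricForm (g : HermitianMetric m M) (φ : OpenPartialHomeomorph M (Cn m)) :
    Cn m → Cn m [⋀^Fin 2]→L[ℝ] ℂ :=
  fun z => ∑ i, ∑ j, (Complex.I * g.matrix φ z i j) • wedge (formDz i) (formDzbar j)

/-- The metric is Kähler: its metric form is closed, `dω = 0`. -/
def IsKahler (g : HermitianMetric m M) : Prop :=
  ∀ φ ∈ atlas (Cn m) M, ∀ z ∈ φ.target, extDeriv (g.metricForm φ) z = 0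

/-- The components of the Chern curvature tensor in the chart `φ`,
`R_{i j̄ k l̄} = - ∂²g_{k l̄}/∂zⁱ∂z̄ʲ + g^{p q̄} (∂g_{k q̄}/∂zⁱ) (∂g_{p l̄}/∂z̄ʲ)`. -/
def chernComp (g : HermitianMetric m M) (φ : OpenPartialHomeomorph M (Cn m)) (z : Cn m)
    (i j k l : Fin m) : ℂ :=
  - dz i (dzbar j fun w => g.matrix φ w k l) z
    + ∑ p, ∑ q, g.inv φ z p q * dz i (fun w => g.matrix φ w k q) z
        * dzbar j (fun w => g.matrix φ w p l) z

/-- The Chern curvature tensor `R(u, v̄, w, ȳ)` at `x` (computed in the preferred chart at `x`). -/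
def chern (g : HermitianMetric m M) (x : M) (u v w y : T m x) : ℂ :=
  ∑ i, ∑ j, ∑ k, ∑ l, g.chernComp (chartAt (Cn m) x) (chartAt (Cn m) x x) i j k l
    * comp x u i * starRingEnd ℂ (comp x v j) * comp x w k * starRingEnd ℂ (comp x y l)

/-- The Chern scalar curvature `S = g^{i j̄} g^{k l̄} R_{i j̄ k l̄}` (a real number). -/
def chernScalar (g : HermitianMetric m M) (x : M) : ℝ :=
  (∑ i, ∑ j, ∑ k, ∑ l, g.inv (chartAt (Cn m) x) (chartAt (Cn m) x x) i j
    * g.inv (chartAt (Cn m) x) (chartAt (Cn m) x x) k l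
    * g.chernComp (chartAt (Cn m) x) (chartAt (Cn m) x x) i j k l).re

/-- The vectors `e₁, …, e_ℓ` at `x` are unitary: `g(eᵢ, ēⱼ) = δᵢⱼ`. -/
def IsUnitary (g : HermitianMetric m M) (x : M) {l : ℕ} (e : Fin l → T m x) : Prop :=
  ∀ i j, g.inner x (e i) (e j) = if i = j then 1 else 0

/-- The vectors `e₁, …, e_ℓ` form a unitary basis of the subspace `V` of `T'ₓM`. -/
def IsUnitaryBasis (g : HermitianMetric m M) (x : M) {l : ℕ} (V : Submodule ℂ (T m x))
    (e : Fin l → T m x) : Prop :=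
  g.IsUnitary x e ∧ Submodule.span ℂ (Set.range e) = V

/-- `Ric_ℓ⁽¹⁾(x, V)(v, v̄) = ∑ᵢ R(v, v̄, eᵢ, ēᵢ)`, for a unitary basis `e` of `V`. -/
def firstRicci (g : HermitianMetric m M) (x : M) {l : ℕ} (e : Fin l → T m x) (v : T m x) : ℝ :=
  ∑ i, (g.chern x v v (e i) (e i)).re

/-- `Ric_ℓ⁽²⁾(x, V)(v, v̄) = ∑ᵢ R(eᵢ, ēᵢ, v, v̄)`, for a unitary basis `e` of `V`. -/
def secondRicci (g : HermitianMetric m M) (x : M) {l : ℕ} (e : Fin l → T m x) (v : T m x) : ℝ :=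
  ∑ i, (g.chern x (e i) (e i) v v).re

/-- `S_ℓ(x, V) = ∑ᵢⱼ R(eᵢ, ēᵢ, eⱼ, ēⱼ)`, for a unitary basis `e` of `V`. -/
def lScalar (g : HermitianMetric m M) (x : M) {l : ℕ} (e : Fin l → T m x) : ℝ :=
  ∑ i, ∑ j, (g.chern x (e i) (e i) (e j) (e j)).re

/-- `Ric_ℓ⁽¹⁾ ≤ c`: for all points `x`, all `ℓ`-dimensional `V ⊆ T'ₓM` and all `v ∈ V`,
`Ric_ℓ⁽¹⁾(x, V)(v, v̄) ≤ c |v|²`. -/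
def FirstRicciLE (g : HermitianMetric m M) (l : ℕ) (c : ℝ) : Prop :=
  ∀ (x : M) (V : Submodule ℂ (T m x)), Module.finrank ℂ V = l →
    ∀ e : Fin l → T m x, g.IsUnitaryBasis x V e →
      ∀ v ∈ V, g.firstRicci x e v ≤ c * (g.inner x v v).re

/-- `Ric_ℓ⁽²⁾ ≥ c`: for all points `x`, all `ℓ`-dimensional `V ⊆ T'ₓM` and all `v ∈ V`,
`Ric_ℓ⁽²⁾(x, V)(v, v̄) ≥ c |v|²`. -/
def SecondRicciGE (g : HermitianMetric m M) (l : ℕ) (c : ℝ) : Prop :=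
  ∀ (x : M) (V : Submodule ℂ (T m x)), Module.finrank ℂ V = l →
    ∀ e : Fin l → T m x, g.IsUnitaryBasis x V e →
      ∀ v ∈ V, c * (g.inner x v v).re ≤ g.secondRicci x e v

/-- `S_ℓ ≥ c`: `S_ℓ(x, V) ≥ c` for all points `x` and all `ℓ`-dimensional `V ⊆ T'ₓM`. -/
def LScalarGE (g : HermitianMetric m M) (l : ℕ) (c : ℝ) : Prop :=
  ∀ (x : M) (V : Submodule ℂ (T m x)), Module.finrank ℂ V = l →
    ∀ e : Fin l → T m x, g.IsUnitaryBasis x V e → c ≤ g.lScalar x e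

/-- The real bisectional curvature
`B̃(e, a) = |a|⁻² ∑ᵢⱼ R(eᵢ, ēᵢ, eⱼ, ēⱼ) aᵢ aⱼ` of a unitary frame `e` and `a ≠ 0`, `aᵢ ≥ 0`. -/
def realBisectional (g : HermitianMetric m M) (x : M) (e : Fin m → T m x) (a : Fin m → ℝ) : ℝ :=
  (1 / ∑ i, a i ^ 2) * ∑ i, ∑ j, (g.chern x (e i) (e i) (e j) (e j)).re * a i * a j

/-- The real bisectional curvature is `≤ c`. -/
def RealBisectionalLE (g : HermitianMetric m M) (c : ℝ) : Prop :=
  ∀ (x : M) (e : Fin m → T m x), g.IsUnitary x e →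
    ∀ a : Fin m → ℝ, (∀ i, 0 ≤ a i) → 0 < ∑ i, a i ^ 2 → g.realBisectional x e a ≤ c

/-- The norm `|v₁ ∧ ⋯ ∧ v_ℓ| = √ det (g(vᵢ, v̄ⱼ))` of a decomposable element of `∧^ℓ T'ₓM`. -/
def wedgeNorm (g : HermitianMetric m M) (x : M) {l : ℕ} (v : Fin l → T m x) : ℝ :=
  √ (Matrix.of fun i j => g.inner x (v i) (v j)).det.re

/-- The inner product on `T'ₓM` given by the metric, with the convention that the inner product
is conjugate linear in its first argument. -/
@[reducible]
def core (g : HermitianMetric m M) (x : M) : InnerProductSpace.Core ℂ (T m x) where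
  inner u v := g.inner x v u
  conj_inner_symm u v := g.conj_symm x v u
  re_inner_nonneg u := by
    by_cases hu : u = 0
    · subst hu; simp
    · exact (g.pos x u hu).le
  add_left u v w := by simp
  smul_left u v r := by simp
  definite u hu := by
    by_contra h
    have h1 := g.pos x u h
    have h2 : g.inner x u u = 0 := hu
    rw [h2] at h1
    simp at h1

end HermitianMetric

end Metric

/-- The singular values, in decreasing order, of a linear map between finite-dimensional complex
vector spaces with given inner products. -/
def singularValuesOf {V W : Type*} [AddCommGroup V] [Module ℂ V] [FiniteDimensional ℂ V]
    [AddCommGroup W] [Module ℂ W] [FiniteDimensional ℂ W]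
    (cV : InnerProductSpace.Core ℂ V) (cW : InnerProductSpace.Core ℂ W) (L : V →ₗ[ℂ] W) :
    ℕ →₀ ℝ :=
  letI : NormedAddCommGroup V := cV.toNormedAddCommGroup
  letI : InnerProductSpace ℂ V := InnerProductSpace.ofCore cV.toCore
  letI : NormedAddCommGroup W := cW.toNormedAddCommGroup
  letI : InnerProductSpace ℂ W := InnerProductSpace.ofCore cW.toCore
  LinearMap.singularValues L

section Maps

variable {m n : ℕ} {M N : Type*} [TopologicalSpace M] [ChartedSpace (Cn m) M]
  [TopologicalSpace N] [ChartedSpace (Cn n) N]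

/-- The tangent map `∂f : T'ₓM → T'_{f(x)}N`. -/
def tmap (f : M → N) (x : M) : T m x →ₗ[ℂ] T n (f x) :=
  (mfderiv 𝓘(ℂ, Cn m) 𝓘(ℂ, Cn n) f x).toLinearMap

/-- The matrix `A_{α β̄} = f*h(∂/∂z^α, ∂/∂z̄^β)` of the pulled back form `f*h` in the chart `φ`,
at the point with coordinates `z`. -/
def pullbackMatrix (h : HermitianMetric n N) (f : M → N)
    (φ : OpenPartialHomeomorph M (Cn m)) (z : Cn m) : Matrix (Fin m) (Fin m) ℂ :=
  Matrix.of fun a b => h.inner (f (φ.symm z))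
    (tmap f (φ.symm z) (coordVec φ z a)) (tmap f (φ.symm z) (coordVec φ z b))

/-- The ratio `(f*h)ᵐ / gᵐ = det (A_{α β̄}) / det (g_{α β̄})` of forms of top degree at `x`. -/
def volumeRatio (g : HermitianMetric m M) (h : HermitianMetric n N) (f : M → N) (x : M) : ℝ :=
  ((pullbackMatrix h f (chartAt (Cn m) x) (chartAt (Cn m) x x)).det
    / (g.matrix (chartAt (Cn m) x) (chartAt (Cn m) x x)).det).re

/-- `‖∧^ℓ ∂f‖₀(x)`, the supremum of `|∧^ℓ ∂f(a)| / |a|` over all decomposable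
`a = v₁ ∧ ⋯ ∧ v_ℓ ≠ 0` in `∧^ℓ T'ₓM`. -/
def wedgeMapNorm (g : HermitianMetric m M) (h : HermitianMetric n N) (f : M → N) (l : ℕ)
    (x : M) : ℝ :=
  sSup {r : ℝ | ∃ v : Fin l → T m x, exteriorPower.ιMulti ℂ l v ≠ 0 ∧
    r = h.wedgeNorm (f x) (fun i => tmap f x (v i)) / g.wedgeNorm x v}

/-- The singular values of `∂f : (T'ₓM, g) → (T'_{f(x)}N, h)` in decreasing order,
`|λ₁| ≥ ⋯ ≥ |λ_m| ≥ 0`, followed by zeros; `|λ_α|` is the value at `α - 1`. -/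
def singVal (g : HermitianMetric m M) (h : HermitianMetric n N) (f : M → N) (x : M) : ℕ →₀ ℝ :=
  haveI : FiniteDimensional ℂ (T m x) := inferInstanceAs (FiniteDimensional ℂ (Cn m))
  haveI : FiniteDimensional ℂ (T n (f x)) := inferInstanceAs (FiniteDimensional ℂ (Cn n))
  singularValuesOf (g.core x) (h.core (f x)) (tmap f x)

/-- `σ_ℓ(x) = |λ₁|² + ⋯ + |λ_ℓ|²`. -/
def sigma (g : HermitianMetric m M) (h : HermitianMetric n N) (f : M → N) (l : ℕ) (x : M) : ℝ :=
  ∑ a ∈ Finset.range l, singVal g h f x a ^ 2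

end Maps

end HermitianGeometry

end

/-! All three estimates are one maximum principle on the compact space of `g`-unitary `l`-frames
over `M`. To a frame `u` is attached the matrix of `f*h(uᵢ, ūⱼ)`, and its determinant ((a) with `l =
m`, and (b)) or its trace (c) is maximised (`exists_isMax`). Rotating a maximising frame `e` at `x`
makes this matrix diagonal with entries `μᵢ ≥ 0`.

Working with frames avoids differentiating singular values, which need not be smooth. Given a
tangent vector `v`, the `eᵢ` are extended holomorphically along a disc in direction `v`, with
vanishing covariant derivative at `x` (`exists_frame_curve`). In the expansion at `t = 0`, the
coefficient of `|t|²` in the `g`-Gram matrix is `-R^g(v, v̄, eᵢ, ēⱼ)`. In the `f*h`-Gram matrix it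
is `⟨sᵢ, sⱼ⟩ - R^h(∂f v, ∂f v, ∂f eᵢ, ∂f eⱼ)`, where `sᵢ` is the covariant derivative of the image
field. The extended frame is unitary only at `x`, so the maximum is compared along the disc through
`det H ≤ max · det G` or `tr (H (2 - G)) ≤ max`, valid for every frame (`gram_det_re_le`,
`gram_trace_re_le`). At a local maximum the coefficient of `|t|²` has nonpositive real part
(`HasJet.re_nonpos`). The terms in `s` have a favourable sign, by Bessel's inequality for the
determinant and by positivity for the trace, so only curvatures remain.

Taking `v = e₁, …, e_l` and summing brings in the curvature hypotheses. For the determinant this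
gives `-K ≤ -κ ∑ μᵢ`, and the arithmetic-geometric mean inequality concludes. For the trace it gives
`-K ∑ μᵢ ≤ -κ ∑ μᵢ²`, and Cauchy–Schwarz concludes. -/

noncomputable section

namespace HermitianGeometry

open Asymptotics Filter Topology

/-! ### Second order expansions in one complex variable, and the maximum principle -/

/-- `u` has at `0 : ℂ` the second order expansion
`u t = a + b t + b' t̄ + c t² + d t t̄ + e t̄² + o(|t|²)` for some `c`, `e`. -/
def HasJet (u : ℂ → ℂ) (a b b' d : ℂ) : Prop :=
  ∃ c e : ℂ, (fun t => u t - (a + b * t + b' * starRingEnd ℂ t + c * t ^ 2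
    + d * (t * starRingEnd ℂ t) + e * starRingEnd ℂ t ^ 2)) =o[𝓝 0] fun t : ℂ => ‖t‖ ^ 2

namespace HasJet

variable {u u₁ u₂ : ℂ → ℂ} {a b b' d a₁ b₁ b₁' d₁ a₂ b₂ b₂' d₂ : ℂ}

theorem congr (hu : HasJet u a b b' d) (h : u =ᶠ[𝓝 0] u₁) : HasJet u₁ a b b' d := by
  obtain ⟨c, e, hc⟩ := hu
  refine ⟨c, e, hc.congr' ?_ (EventuallyEq.refl _ _)⟩
  filter_upwards [h] with t ht
  rw [ht]

theorem cast (hu : HasJet u a b b' d) (ha : a = a₁) (hb : b = b₁) (hb' : b' = b₁')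
    (hd : d = d₁) : HasJet u a₁ b₁ b₁' d₁ := by
  subst ha hb hb' hd; exact hu

theorem const (a : ℂ) : HasJet (fun _ => a) a 0 0 0 :=
  ⟨0, 0, by simp⟩

theorem id : HasJet (fun t => t) 0 1 0 0 :=
  ⟨0, 0, by simp⟩

theorem add (h₁ : HasJet u₁ a₁ b₁ b₁' d₁) (h₂ : HasJet u₂ a₂ b₂ b₂' d₂) :
    HasJet (fun t => u₁ t + u₂ t) (a₁ + a₂) (b₁ + b₂) (b₁' + b₂') (d₁ + d₂) := by
  obtain ⟨c₁, e₁, h₁⟩ := h₁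
  obtain ⟨c₂, e₂, h₂⟩ := h₂
  refine ⟨c₁ + c₂, e₁ + e₂, (h₁.add h₂).congr_left fun t => ?_⟩
  ring

theorem conj (h : HasJet u a b b' d) :
    HasJet (fun t => starRingEnd ℂ (u t)) (starRingEnd ℂ a) (starRingEnd ℂ b') (starRingEnd ℂ b)
      (starRingEnd ℂ d) := by
  obtain ⟨c, e, h⟩ := h
  refine ⟨starRingEnd ℂ e, starRingEnd ℂ c, ?_⟩
  refine IsLittleO.of_norm_left (h.norm_left.congr_left fun t => ?_)
  rw [← Complex.norm_conj]
  congr 1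
  simp only [map_sub, map_add, map_mul, map_pow, Complex.conj_conj]
  ring

theorem isBigO_one (h : HasJet u a b b' d) : u =O[𝓝 0] fun _ => (1 : ℝ) := by
  obtain ⟨c, e, h⟩ := h
  have h1 : (fun t : ℂ => ‖t‖ ^ 2) =O[𝓝 0] fun _ => (1 : ℝ) := by
    have : ContinuousAt (fun t : ℂ => ‖t‖ ^ 2) 0 := by fun_prop
    exact this.tendsto.isBigO_one ℝ
  have h2 : (fun t : ℂ => a + b * t + b' * starRingEnd ℂ t + c * t ^ 2
      + d * (t * starRingEnd ℂ t) + e * starRingEnd ℂ t ^ 2) =O[𝓝 0] fun _ => (1 : ℝ) := by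
    have : ContinuousAt (fun t : ℂ => a + b * t + b' * starRingEnd ℂ t + c * t ^ 2
      + d * (t * starRingEnd ℂ t) + e * starRingEnd ℂ t ^ 2) 0 := by
      have := Complex.continuous_conj
      fun_prop
    exact this.tendsto.isBigO_one ℝ
  exact ((h.isBigO.trans h1).add h2).congr_left fun t => by ring

theorem tendsto (h : HasJet u a b b' d) : Tendsto u (𝓝 0) (𝓝 a) := by
  obtain ⟨c, e, h⟩ := h
  have h1 : Tendsto (fun t : ℂ => ‖t‖ ^ 2) (𝓝 0) (𝓝 0) := by
    have : Continuous fun t : ℂ => ‖t‖ ^ 2 := by fun_prop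
    simpa using this.tendsto 0
  have h2 : Tendsto (fun t : ℂ => a + b * t + b' * starRingEnd ℂ t + c * t ^ 2
      + d * (t * starRingEnd ℂ t) + e * starRingEnd ℂ t ^ 2) (𝓝 0) (𝓝 a) := by
    have := Complex.continuous_conj
    have h3 : Continuous fun t : ℂ => a + b * t + b' * starRingEnd ℂ t + c * t ^ 2
      + d * (t * starRingEnd ℂ t) + e * starRingEnd ℂ t ^ 2 := by fun_prop
    simpa using h3.tendsto 0
  simpa using (h.trans_tendsto h1).add h2

theorem isBigO_sq (h : HasJet u 0 0 0 d) : u =O[𝓝 0] fun t : ℂ => ‖t‖ ^ 2 := by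
  obtain ⟨c, e, h⟩ := h
  have h2 : (fun t : ℂ => c * t ^ 2 + d * (t * starRingEnd ℂ t) + e * starRingEnd ℂ t ^ 2)
      =O[𝓝 0] fun t : ℂ => ‖t‖ ^ 2 := by
    refine ((IsBigO.const_mul_left ?_ c).add (IsBigO.const_mul_left ?_ d)).add
      (IsBigO.const_mul_left ?_ e)
    all_goals exact IsBigO.of_bound 1 (Eventually.of_forall fun t => by simp [sq])
  exact (h.isBigO.add h2).congr_left fun t => by ring

theorem of_isLittleO (h : u =o[𝓝 0] fun t : ℂ => ‖t‖ ^ 2) : HasJet u 0 0 0 0 :=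
  ⟨0, 0, h.congr_left fun t => by ring⟩

theorem mul (h₁ : HasJet u₁ a₁ b₁ b₁' d₁) (h₂ : HasJet u₂ a₂ b₂ b₂' d₂) :
    HasJet (fun t => u₁ t * u₂ t) (a₁ * a₂) (a₁ * b₂ + b₁ * a₂) (a₁ * b₂' + b₁' * a₂)
      (a₁ * d₂ + b₁ * b₂' + b₁' * b₂ + d₁ * a₂) := by
  have hO := h₂.isBigO_one
  obtain ⟨c₁, e₁, h₁⟩ := h₁
  obtain ⟨c₂, e₂, h₂⟩ := h₂
  refine ⟨a₁ * c₂ + b₁ * b₂ + c₁ * a₂, a₁ * e₂ + b₁' * b₂' + e₁ * a₂, ?_⟩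
  have hP : (fun t : ℂ => a₁ + b₁ * t + b₁' * starRingEnd ℂ t + c₁ * t ^ 2
      + d₁ * (t * starRingEnd ℂ t) + e₁ * starRingEnd ℂ t ^ 2) =O[𝓝 0] fun _ => (1 : ℝ) := by
    have : ContinuousAt (fun t : ℂ => a₁ + b₁ * t + b₁' * starRingEnd ℂ t + c₁ * t ^ 2
      + d₁ * (t * starRingEnd ℂ t) + e₁ * starRingEnd ℂ t ^ 2) 0 := by
      have := Complex.continuous_conj
      fun_prop
    exact this.tendsto.isBigO_one ℝ
  have k1 := h₁.mul_isBigO hO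
  have k2 := hP.mul_isLittleO h₂
  simp only [mul_one, one_mul] at k1 k2
  have k0 : ∀ φ : ℂ → ℂ, Continuous φ → φ 0 = 0 → φ =o[𝓝 0] fun _ => (1 : ℝ) := by
    intro φ hφ h0
    have h := hφ.tendsto 0
    rw [isLittleO_one_iff]
    rwa [h0] at h
  -- Every monomial of degree at least three in `t`, `t̄` is divisible by `t²` or by `t̄²`, with a
  -- cofactor vanishing at `0`. This covers all terms of the product of the two polynomials beyond
  -- second order.
  have k3 : ∀ φ : ℂ → ℂ, Continuous φ → φ 0 = 0 →
      (fun t : ℂ => t ^ 2 * φ t) =o[𝓝 0] fun t : ℂ => ‖t‖ ^ 2 * 1 := fun φ hφ h0 =>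
    (IsBigO.of_bound 1 (Eventually.of_forall fun t => by simp)).mul_isLittleO (k0 φ hφ h0)
  have k4 : ∀ φ : ℂ → ℂ, Continuous φ → φ 0 = 0 →
      (fun t : ℂ => starRingEnd ℂ t ^ 2 * φ t) =o[𝓝 0] fun t : ℂ => ‖t‖ ^ 2 * 1 := fun φ hφ h0 =>
    (IsBigO.of_bound 1 (Eventually.of_forall fun t => by simp)).mul_isLittleO (k0 φ hφ h0)
  have hcc := Complex.continuous_conj
  have k5 := k3 (fun t => (b₁ * c₂ + c₁ * b₂) * t
    + (b₁ * d₂ + d₁ * b₂ + b₁' * c₂ + c₁ * b₂') * starRingEnd ℂ t + c₁ * c₂ * t ^ 2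
    + (c₁ * d₂ + d₁ * c₂) * (t * starRingEnd ℂ t)
    + (c₁ * e₂ + e₁ * c₂ + d₁ * d₂) * starRingEnd ℂ t ^ 2) (by fun_prop) (by simp)
  have k6 := k4 (fun t => (b₁ * e₂ + e₁ * b₂ + b₁' * d₂ + d₁ * b₂') * t
    + (b₁' * e₂ + e₁ * b₂') * starRingEnd ℂ t + (d₁ * e₂ + e₁ * d₂) * (t * starRingEnd ℂ t)
    + e₁ * e₂ * starRingEnd ℂ t ^ 2) (by fun_prop) (by simp)
  simp only [mul_one] at k5 k6
  refine ((k1.add k2).add (k5.add k6)).congr_left fun t => ?_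
  ring

theorem const_mul (h : HasJet u a b b' d) (k : ℂ) :
    HasJet (fun t => k * u t) (k * a) (k * b) (k * b') (k * d) :=
  ((const k).mul h).cast rfl (by ring) (by ring) (by ring)

theorem neg (h : HasJet u a b b' d) : HasJet (fun t => -u t) (-a) (-b) (-b') (-d) :=
  ((h.const_mul (-1)).congr (Eventually.of_forall fun t => by simp)).cast
    (by ring) (by ring) (by ring) (by ring)

theorem sub (h₁ : HasJet u₁ a₁ b₁ b₁' d₁) (h₂ : HasJet u₂ a₂ b₂ b₂' d₂) :
    HasJet (fun t => u₁ t - u₂ t) (a₁ - a₂) (b₁ - b₂) (b₁' - b₂') (d₁ - d₂) := by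
  simpa only [sub_eq_add_neg] using h₁.add h₂.neg

theorem sum {ι : Type*} (s : Finset ι) {u : ι → ℂ → ℂ} {a b b' d : ι → ℂ}
    (h : ∀ i ∈ s, HasJet (u i) (a i) (b i) (b' i) (d i)) :
    HasJet (fun t => ∑ i ∈ s, u i t) (∑ i ∈ s, a i) (∑ i ∈ s, b i) (∑ i ∈ s, b' i)
      (∑ i ∈ s, d i) := by
  classical
  induction s using Finset.induction_on with
  | empty => simpa using const 0
  | insert i s hi ih =>
    simp only [Finset.sum_insert hi]
    exact (h i (Finset.mem_insert_self _ _)).add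
      (ih fun j hj => h j (Finset.mem_insert_of_mem hj))

/-- A holomorphic function has a second order expansion in powers of `t` alone. -/
theorem of_analyticAt (h : AnalyticAt ℂ u 0) : HasJet u (u 0) (deriv u 0) 0 0 := by
  obtain ⟨p, hp⟩ := h
  have h1 := hp.isBigO_sub_partialSum_pow 3
  refine ⟨p.coeff 2, 0, ?_⟩
  have h3 : (fun t : ℂ => ‖t‖ ^ 3) =o[𝓝 0] fun t : ℂ => ‖t‖ ^ 2 :=
    (isLittleO_pow_pow (by norm_num)).comp_tendsto (by simpa using (continuous_norm (E := ℂ)).tendsto 0)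
  refine (h1.trans_isLittleO h3).congr_left fun t => ?_
  have e0 : p.coeff 0 = u 0 := by
    rw [← hp.coeff_zero (fun _ => 0)]; rw [FormalMultilinearSeries.coeff]; congr 1; ext i; exact i.elim0
  have e1 : p.coeff 1 = deriv u 0 := hp.deriv.symm
  simp [FormalMultilinearSeries.partialSum, Finset.sum_range_succ, e0, e1]
  ring

/-- The maximum principle: if the real part of `u` has a local maximum at `0`, then the mixed
second order coefficient has nonpositive real part. -/
theorem re_nonpos (h : HasJet u a b b' d) (hmax : ∀ᶠ t in 𝓝 0, (u t).re ≤ a.re) : d.re ≤ 0 := by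
  obtain ⟨c, e, h⟩ := h
  -- Adding the values at `r`, `-r`, `ir`, `-ir` cancels the terms in `t`, `t̄`, `t²` and `t̄²` and
  -- leaves `4a + 4dr²`.
  have hk : ∀ k : ℂ, Tendsto (fun r : ℝ => k * (r : ℂ)) (𝓝 0) (𝓝 0) := fun k => by
    have : Continuous fun r : ℝ => k * (r : ℂ) := by fun_prop
    simpa using this.tendsto 0
  have h1 := h.comp_tendsto (hk 1)
  have h2 := h.comp_tendsto (hk (-1))
  have h3 := h.comp_tendsto (hk Complex.I)
  have h4 := h.comp_tendsto (hk (-Complex.I))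
  have m1 := (hk 1).eventually hmax
  have m2 := (hk (-1)).eventually hmax
  have m3 := (hk Complex.I).eventually hmax
  have m4 := (hk (-Complex.I)).eventually hmax
  simp only [Function.comp_def, norm_mul, norm_one, norm_neg, Complex.norm_I, one_mul,
    Complex.norm_real, Real.norm_eq_abs, sq_abs] at h1 h2 h3 h4
  have key := ((h1.add h2).add h3).add h4
  by_contra! hd
  -- If `d.re > 0`, the tolerance `d.re` costs at most `d.re · r²` out of `4 d.re · r²`, so the sum
  -- of the four values still exceeds `4 a.re`.
  have hb := key.bound (show (0 : ℝ) < d.re by exact hd)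
  have hall := ((((hb.and m1).and m2).and m3).and m4)
  have hne : ∃ᶠ r : ℝ in 𝓝 0, r ≠ 0 := by
    have : (𝓝[≠] (0 : ℝ)).NeBot := inferInstance
    exact Filter.frequently_iff_neBot.2 this
  obtain ⟨r, hr, ⟨⟨⟨hb, m1⟩, m2⟩, m3⟩, m4⟩ := (hne.and_eventually hall).exists
  have hre := (Complex.abs_re_le_norm _).trans hb
  have hle := (abs_le.1 hre).1
  simp only [Complex.add_re, Complex.sub_re, map_mul, Complex.conj_ofReal, map_neg, Complex.conj_I,
    map_one] at hle
  have I2 : Complex.I ^ 2 = -1 := Complex.I_sq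
  have e3 : (Complex.I * (r : ℂ)) * (-Complex.I * r) = r ^ 2 := by linear_combination (-r^2 : ℂ) * I2
  have e4 : (-Complex.I * (r : ℂ)) * (- -Complex.I * r) = r ^ 2 := by
    linear_combination (-r^2 : ℂ) * I2
  have e5 : (Complex.I * (r : ℂ)) ^ 2 = - r ^ 2 := by linear_combination (r^2 : ℂ) * I2
  have e6 : (-Complex.I * (r : ℂ)) ^ 2 = - r ^ 2 := by linear_combination (r^2 : ℂ) * I2
  have e7 : (- -Complex.I * (r : ℂ)) ^ 2 = - r ^ 2 := by linear_combination (r^2 : ℂ) * I2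
  rw [e3, e4, e5, e6, e7] at hle
  have hr2 : 0 < r ^ 2 := by positivity
  rw [← Complex.ofReal_pow] at hle
  simp [Complex.mul_re, sq] at hle m1 m2 m3 m4
  nlinarith [mul_pos hd hr2]

end HasJet

/-! ### Taylor expansion and Wirtinger derivatives -/

/-- Taylor's theorem of second order, with Peano remainder. -/
theorem taylor_two_isLittleO {E F : Type*} [NormedAddCommGroup E] [NormedSpace ℝ E]
    [NormedAddCommGroup F] [NormedSpace ℝ F] {G : E → F} {x : E} (hG : ContDiffAt ℝ 2 G x) :
    (fun y => G y - (G x + fderiv ℝ G x (y - x)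
      + (1 / 2 : ℝ) • fderiv ℝ (fderiv ℝ G) x (y - x) (y - x))) =o[𝓝 x]
      fun y => ‖y - x‖ ^ 2 := by
  have hd : ∀ᶠ y in 𝓝 x, DifferentiableAt ℝ G y := by
    filter_upwards [hG.eventually (by simp)] with y hy using hy.differentiableAt (by simp)
  obtain ⟨r, hr, hball⟩ := Metric.eventually_nhds_iff_ball.1 hd
  have hG' : DifferentiableAt ℝ (fderiv ℝ G) x :=
    (hG.fderiv_right (m := 1) (by norm_num)).differentiableAt (by simp)
  have hsymm : IsSymmSndFDerivAt ℝ G x := hG.isSymmSndFDerivAt (by simp)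
  set B := fderiv ℝ (fderiv ℝ G) x with hB
  have h1 := hG'.hasFDerivAt.isLittleO
  -- The remainder vanishes at `x` and its derivative is `o(‖y - x‖)`, which integrates to `o(‖y -
  -- x‖²)`. Symmetry of the second derivative identifies the derivative of the quadratic term.
  have key := (convex_ball x r).isLittleO_pow_succ (n := 1) (x₀ := x)
    (f := fun y => G y - (G x + fderiv ℝ G x (y - x) + (1 / 2 : ℝ) • B (y - x) (y - x)))
    (f' := fun y => fderiv ℝ G y - fderiv ℝ G x - B (y - x)) (Metric.mem_ball_self hr) ?_ ?_
  · rw [nhdsWithin_eq_nhds.2 (Metric.ball_mem_nhds x hr)] at key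
    simpa using key
  · intro y hy
    refine HasFDerivAt.hasFDerivWithinAt ?_
    have hs : HasFDerivAt (fun y => y - x) (ContinuousLinearMap.id ℝ E) y :=
      (hasFDerivAt_id y).sub_const x
    have h2 := ((B.hasFDerivAt (x := y - x)).comp y hs).clm_apply hs
    have h3 := (fderiv ℝ G x).hasFDerivAt (x := y - x) |>.comp y hs
    have h4 := (hball y hy).hasFDerivAt.sub ((h3.const_add (G x)).add (h2.const_smul (1 / 2 : ℝ)))
    refine h4.congr_fderiv ?_
    ext w
    have : B w (y - x) = B (y - x) w := hsymm w (y - x)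
    have h2 : (1 / 2 : ℝ) • (B (y - x) w + B w (y - x)) = B (y - x) w := by
      rw [this, ← two_smul ℝ (B (y - x) w), smul_smul]
      norm_num
    change fderiv ℝ G y w - (fderiv ℝ G x w + (1 / 2 : ℝ) • (B (y - x) w + B w (y - x)))
      = fderiv ℝ G y w - fderiv ℝ G x w - B (y - x) w
    rw [h2]
    abel
  · rw [nhdsWithin_eq_nhds.2 (Metric.ball_mem_nhds x hr)]
    simpa [pow_one] using h1.norm_right

section Wirtinger

variable {m : ℕ}

/-- The coefficient of `zⁱ` of a real-linear form on `ℂᵐ`. -/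
def lz (i : Fin m) : (Cn m →L[ℝ] ℂ) →L[ℝ] ℂ :=
  (1 / 2 : ℂ) • (ContinuousLinearMap.apply ℝ ℂ (EuclideanSpace.single i (1 : ℂ) : Cn m)
    - Complex.I • ContinuousLinearMap.apply ℝ ℂ (EuclideanSpace.single i Complex.I : Cn m))

/-- The coefficient of `z̄ⁱ` of a real-linear form on `ℂᵐ`. -/
def lzbar (i : Fin m) : (Cn m →L[ℝ] ℂ) →L[ℝ] ℂ :=
  (1 / 2 : ℂ) • (ContinuousLinearMap.apply ℝ ℂ (EuclideanSpace.single i (1 : ℂ) : Cn m)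
    + Complex.I • ContinuousLinearMap.apply ℝ ℂ (EuclideanSpace.single i Complex.I : Cn m))

theorem dz_eq_lz (i : Fin m) (G : Cn m → ℂ) (z : Cn m) : dz i G z = lz i (fderiv ℝ G z) := by
  simp [dz, lz]

theorem dzbar_eq_lzbar (i : Fin m) (G : Cn m → ℂ) (z : Cn m) :
    dzbar i G z = lzbar i (fderiv ℝ G z) := by
  simp [dzbar, lzbar, mul_add]

/-- A real-linear form on `ℂᵐ` is a combination of the `zⁱ` and `z̄ⁱ`. -/
theorem apply_eq_sum_lz (A : Cn m →L[ℝ] ℂ) (v : Cn m) :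
    A v = ∑ i, (lz i A * v i + lzbar i A * starRingEnd ℂ (v i)) := by
  have hv : v = ∑ i, ((v i).re • (EuclideanSpace.single i (1 : ℂ) : Cn m)
      + (v i).im • (EuclideanSpace.single i Complex.I : Cn m)) := by
    ext j
    simp [Finset.sum_add_distrib, Pi.single_apply]
  conv_lhs => rw [hv]
  rw [map_sum]
  refine Finset.sum_congr rfl fun i _ => ?_
  simp only [map_add, map_smul, lz, lzbar, smul_apply,
    sub_apply, add_apply, ContinuousLinearMap.apply_apply,
    smul_eq_mul, Complex.real_smul]
  have h1 : (v i).re + (v i).im * Complex.I = v i := Complex.re_add_im _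
  have h2 : starRingEnd ℂ (v i) = (v i).re - (v i).im * Complex.I := by
    apply Complex.ext <;> simp
  rw [h2]
  nth_rewrite 3 [← h1]
  linear_combination ((v i).im * A (EuclideanSpace.single i Complex.I) : ℂ) * Complex.I_sq

theorem dz_conj {G : Cn m → ℂ} {z : Cn m} (hG : DifferentiableAt ℝ G z) (i : Fin m) :
    dz i (fun w => starRingEnd ℂ (G w)) z = starRingEnd ℂ (dzbar i G z) := by
  have : fderiv ℝ (fun w => starRingEnd ℂ (G w)) z
      = (Complex.conjCLE : ℂ →L[ℝ] ℂ).comp (fderiv ℝ G z) :=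
    ((Complex.conjCLE : ℂ →L[ℝ] ℂ).hasFDerivAt.comp z hG.hasFDerivAt).fderiv
  rw [dz, this, dzbar]
  simp only [map_mul, map_add, Complex.conj_I, map_div₀, map_one, map_ofNat]
  simp [sub_eq_add_neg]

theorem dz_dzbar_eq {G : Cn m → ℂ} {z : Cn m} (hG : ContDiffAt ℝ 2 G z) (i j : Fin m) :
    dz i (dzbar j G) z
      = lz i ((lzbar j).comp (fderiv ℝ (fderiv ℝ G) z)) := by
  have hG' : DifferentiableAt ℝ (fderiv ℝ G) z :=
    (hG.fderiv_right (m := 1) (by norm_num)).differentiableAt (by simp)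
  have : dzbar j G = fun w => lzbar j (fderiv ℝ G w) := funext fun w => dzbar_eq_lzbar j G w
  rw [dz_eq_lz, this]
  congr 1
  exact ((lzbar j).hasFDerivAt.comp z hG'.hasFDerivAt).fderiv

theorem lz_lzbar_symm {B : Cn m →L[ℝ] Cn m →L[ℝ] ℂ} (hB : ∀ v w, B v w = B w v) (i j : Fin m) :
    lz i ((lzbar j).comp B) = lzbar j ((lz i).comp B) := by
  simp only [lz, lzbar, smul_apply, ContinuousLinearMap.comp_apply,
    sub_apply, add_apply, ContinuousLinearMap.apply_apply,
    smul_eq_mul]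
  rw [hB (EuclideanSpace.single j 1) (EuclideanSpace.single i 1),
    hB (EuclideanSpace.single j 1) (EuclideanSpace.single i Complex.I),
    hB (EuclideanSpace.single j Complex.I) (EuclideanSpace.single i 1),
    hB (EuclideanSpace.single j Complex.I) (EuclideanSpace.single i Complex.I)]
  ring

end Wirtinger

/-! ### Chain rule and determinant for second order expansions -/

namespace HasJet

variable {m : ℕ}

/-- The chain rule of second order for the composition of a smooth function with a holomorphic
curve. -/
theorem comp_curve {G : Cn m → ℂ} {γ : ℂ → Cn m} {v : Fin m → ℂ} (hG : ContDiffAt ℝ 2 G (γ 0))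
    (hc : ContinuousAt γ 0) (hγ : ∀ i, HasJet (fun t => γ t i) (γ 0 i) (v i) 0 0) :
    HasJet (fun t => G (γ t)) (G (γ 0)) (∑ i, dz i G (γ 0) * v i)
      (∑ i, dzbar i G (γ 0) * starRingEnd ℂ (v i))
      (∑ i, ∑ j, dz i (dzbar j G) (γ 0) * v i * starRingEnd ℂ (v j)) := by
  have hζ : ∀ i, HasJet (fun t => (γ t - γ 0) i) 0 (v i) 0 0 := fun i =>
    ((hγ i).sub (const (γ 0 i))).cast (by simp) (by simp) (by simp) (by simp)
  have hζc : ∀ i, HasJet (fun t => starRingEnd ℂ ((γ t - γ 0) i)) 0 0 (starRingEnd ℂ (v i)) 0 :=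
    fun i => (hζ i).conj.cast (by simp) (by simp) (by simp) (by simp)
  have hlin : ∀ A : Cn m →L[ℝ] ℂ, HasJet (fun t => A (γ t - γ 0)) 0 (∑ i, lz i A * v i)
      (∑ i, lzbar i A * starRingEnd ℂ (v i)) 0 := fun A => by
    simp only [apply_eq_sum_lz A]
    exact (sum Finset.univ fun i _ => ((hζ i).const_mul (lz i A)).add
      ((hζc i).const_mul (lzbar i A))).cast (by simp) (by simp) (by simp) (by simp)
  set B := fderiv ℝ (fderiv ℝ G) (γ 0) with hB
  have hsymm : ∀ x y, B x y = B y x := fun x y => hG.isSymmSndFDerivAt (by simp) x y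
  -- The mixed term appears once through `∂ᵢ∂̄ⱼ` and once through `∂̄ⱼ∂ᵢ`. These agree by symmetry,
  -- and the resulting `2` cancels Taylor's `1/2`.
  have hquad : HasJet (fun t => B (γ t - γ 0) (γ t - γ 0)) 0 0 0
      (2 * ∑ i, ∑ j, dz i (dzbar j G) (γ 0) * v i * starRingEnd ℂ (v j)) := by
    have e : ∀ x, B x x = ∑ i, ((lz i).comp B x * x i + (lzbar i).comp B x * starRingEnd ℂ (x i)) :=
      fun x => by rw [apply_eq_sum_lz (B x)]; rfl
    simp only [e]
    refine (sum Finset.univ fun i _ => ((hlin ((lz i).comp B)).mul (hζ i)).add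
      ((hlin ((lzbar i).comp B)).mul (hζc i))).cast (by simp) (by simp) (by simp) ?_
    simp only [mul_zero, add_zero, zero_add, Finset.sum_add_distrib, two_mul,
      Finset.sum_mul]
    congr 1
    · refine Finset.sum_congr rfl fun i _ => Finset.sum_congr rfl fun j _ => ?_
      rw [dz_dzbar_eq hG, lz_lzbar_symm hsymm]
      ring
    · rw [Finset.sum_comm]
      refine Finset.sum_congr rfl fun i _ => Finset.sum_congr rfl fun j _ => ?_
      rw [dz_dzbar_eq hG]
  have hO : (fun t => ‖γ t - γ 0‖ ^ 2) =O[𝓝 0] fun t : ℂ => ‖t‖ ^ 2 := by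
    simp only [EuclideanSpace.norm_sq_eq]
    refine IsBigO.fun_sum (g := fun t : ℂ => ‖t‖ ^ 2) fun i _ => ?_
    have h0 := ((hζ i).mul (hζ i)).cast (a₁ := 0) (b₁ := 0) (b₁' := 0)
      (by simp) (by simp) (by simp) rfl
    exact (isBigO_norm_left.2 h0.isBigO_sq).congr_left fun t => by simp [sq]
  have hrem := ((taylor_two_isLittleO hG).comp_tendsto hc).trans_isBigO hO
  have := (((const (G (γ 0))).add (hlin (fderiv ℝ G (γ 0)))).add
    (hquad.const_mul (1 / 2))).add (of_isLittleO hrem)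
  refine (this.congr (Eventually.of_forall fun t => ?_)).cast ?_ ?_ ?_ ?_
  · simp [← hB, Complex.real_smul]
  · simp
  · simp [dz_eq_lz]
  · simp [dzbar_eq_lzbar]
  · simp

/-- The second order expansion of a determinant at the identity. -/
theorem det {l : ℕ} {X : ℂ → Matrix (Fin l) (Fin l) ℂ} {B B' D : Matrix (Fin l) (Fin l) ℂ}
    (hX : ∀ i j, HasJet (fun t => X t i j) (if i = j then 1 else 0) (B i j) (B' i j) (D i j)) :
    HasJet (fun t => (X t).det) 1 B.trace B'.trace
      (D.trace + B.trace * B'.trace - (B * B').trace) := by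
  set δ : Fin l → Fin l → ℂ := fun i j => if i = j then 1 else 0 with hδ
  have hof : Matrix.of δ = 1 := by ext i j; simp [hδ, Matrix.one_apply]
  let det' : (Fin l → Fin l → ℂ) → ℂ := fun A => (Matrix.of A).det
  have hcd : ContDiff ℂ 1 det' := by
    have : det' = fun A => ∑ σ : Equiv.Perm (Fin l), ((Equiv.Perm.sign σ : ℤ) : ℂ)
        * ∏ i, A (σ i) i := by
      funext A; simp [det', Matrix.det_apply']
    rw [this]
    fun_prop
  have hstrict := hcd.contDiffAt.hasStrictFDerivAt (x := δ) (by simp)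
  have htr : ∀ Y : Fin l → Fin l → ℂ, fderiv ℂ det' δ Y = ∑ i, Y i i := by
    intro Y
    have h1 : HasDerivAt (fun r : ℂ => det' (δ + r • Y)) (fderiv ℂ det' δ Y) 0 := by
      have h2 : HasDerivAt (fun r : ℂ => δ + r • Y) ((1 : ℂ) • Y) 0 :=
        ((hasDerivAt_id (0 : ℂ)).smul_const Y).const_add δ
      have h3 : HasFDerivAt det' (fderiv ℂ det' δ) (δ + (0 : ℂ) • Y) := by
        simpa using hstrict.hasFDerivAt
      rw [one_smul] at h2
      exact h3.comp_hasDerivAt 0 h2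
    have h4 : HasDerivAt (fun r : ℂ => det' (δ + r • Y)) (∑ i, Y i i) 0 := by
      -- The derivative of the determinant at the identity is the trace, read off from `det (1 + rY)
      -- = 1 + r tr Y + r² p(r)` with a polynomial `p`.
      have : (fun r : ℂ => det' (δ + r • Y)) = fun r => 1 + Matrix.trace (Matrix.of Y) * r
          + (Matrix.det (1 + (Polynomial.X : Polynomial ℂ)
            • (Matrix.of Y).map Polynomial.C)).divX.divX.eval r * r ^ 2 := by
        funext r
        rw [← Matrix.det_one_add_smul, ← hof]
        rfl
      rw [this]
      set p := (Matrix.det (1 + (Polynomial.X : Polynomial ℂ)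
            • (Matrix.of Y).map Polynomial.C)).divX.divX
      have h5 := (((hasDerivAt_id (0 : ℂ)).const_mul (Matrix.trace (Matrix.of Y))).const_add
        1).add ((p.hasDerivAt 0).mul (hasDerivAt_pow 2 (0 : ℂ)))
      refine h5.congr_deriv ?_
      simp [Matrix.trace]
    exact h1.unique h4
  have hpoly : ∀ A : Matrix (Fin l) (Fin l) ℂ, HasJet (fun t => (1 + t • A).det) 1 A.trace 0 0 := by
    intro A
    set p := (Matrix.det (1 + (Polynomial.X : Polynomial ℂ) • A.map Polynomial.C)).divX.divX with hp
    have h5 : HasJet (fun t => p.eval t) (p.eval 0) (deriv (fun t => p.eval t) 0) 0 0 :=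
      of_analyticAt (AnalyticOnNhd.eval_polynomial p 0 trivial)
    have h6 := ((const 1).add (id.const_mul A.trace)).add (h5.mul (id.mul id))
    refine (h6.congr (Eventually.of_forall fun t => ?_)).cast ?_ ?_ ?_ ?_
    · rw [Matrix.det_one_add_smul, ← hp]; ring
    all_goals simp
  have hpoly' : HasJet (fun t => (1 + starRingEnd ℂ t • B').det) 1 0 B'.trace 0 := by
    refine ((hpoly B'.conjTranspose).conj.congr (Eventually.of_forall fun t => ?_)).cast ?_ ?_ ?_ ?_
    · change star _ = _
      rw [← Matrix.det_conjTranspose]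
      simp
    all_goals simp [Matrix.trace_conjTranspose]
  -- A model with the first order terms of `X` whose determinant splits into a holomorphic and an
  -- antiholomorphic factor. The coefficient of `|t|²` is therefore `tr B · tr B'` in `det P`, and
  -- `B B'` in `P` itself.
  let P : ℂ → Matrix (Fin l) (Fin l) ℂ := fun t => (1 + t • B) * (1 + starRingEnd ℂ t • B')
  have hPdet : HasJet (fun t => (P t).det) 1 B.trace B'.trace (B.trace * B'.trace) := by
    refine (((hpoly B).mul hpoly').congr (Eventually.of_forall fun t => ?_)).cast
      ?_ ?_ ?_ ?_
    · exact (Matrix.det_mul _ _).symm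
    all_goals simp
  have hPij : ∀ i j, HasJet (fun t => P t i j) (δ i j) (B i j) (B' i j) ((B * B') i j) := by
    intro i j
    have hid : HasJet (fun t => starRingEnd ℂ t) 0 0 1 0 := by simpa using id.conj
    have h := (((const (δ i j)).add (id.const_mul (B i j))).add (hid.const_mul (B' i j))).add
      ((id.mul hid).const_mul ((B * B') i j))
    refine (h.congr (Eventually.of_forall fun t => ?_)).cast ?_ ?_ ?_ ?_
    · simp only [P, add_mul, mul_add, Matrix.smul_mul, Matrix.mul_smul, Matrix.add_apply,
        Matrix.smul_apply, Matrix.one_mul, Matrix.mul_one, smul_eq_mul]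
      rw [← hof, Matrix.of_apply]
      ring
    all_goals simp
  have hdiff : ∀ i j, HasJet (fun t => X t i j - P t i j) 0 0 0 (D i j - (B * B') i j) := fun i j =>
    ((hX i j).sub (hPij i j)).cast (sub_self _) (sub_self _) (sub_self _) rfl
  have htends : ∀ Z : ℂ → Matrix (Fin l) (Fin l) ℂ, ∀ b b' d : Fin l → Fin l → ℂ,
      (∀ i j, HasJet (fun t => Z t i j) (δ i j) (b i j) (b' i j) (d i j)) →
      Tendsto (fun t => (fun i j => Z t i j : Fin l → Fin l → ℂ)) (𝓝 0) (𝓝 δ) := by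
    intro Z b b' d hZ
    refine tendsto_pi_nhds.2 fun i => tendsto_pi_nhds.2 fun j => ?_
    exact (hZ i j).tendsto
  -- Since `X - P = O(|t|²)`, strict differentiability at the identity gives `det X - det P = tr (X
  -- - P) + o(|t|²)`. Plain differentiability would not control the difference at two moving points.
  have hlo := hstrict.isLittleO.comp_tendsto ((htends X _ _ _ hX).prodMk_nhds (htends P _ _ _ hPij))
  have hO : (fun t => ((fun i j => X t i j - P t i j : Fin l → Fin l → ℂ)))
      =O[𝓝 0] fun t : ℂ => ‖t‖ ^ 2 :=
    isBigO_pi.2 fun i => isBigO_pi.2 fun j => (hdiff i j).isBigO_sq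
  have hrem := of_isLittleO (hlo.trans_isBigO hO)
  have htrace : HasJet (fun t => ∑ i, (X t i i - P t i i)) 0 0 0 (D.trace - (B * B').trace) :=
    (sum Finset.univ fun i _ => hdiff i i).cast (by simp) (by simp) (by simp)
      (by simp [Matrix.trace])
  refine (((hPdet.add htrace).add hrem).congr (Eventually.of_forall fun t => ?_)).cast
    (by simp) (by simp) (by simp) (by ring)
  have e := htr (fun i j => X t i j - P t i j)
  simp only [Function.comp_def]
  have e' : fderiv ℂ det' δ ((fun i j => X t i j) - fun i j => P t i j)
      = ∑ i, (X t i i - P t i i) := e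
  rw [e']
  change (P t).det + _ + ((X t).det - (P t).det - _) = (X t).det
  ring

end HasJet

open Matrix

/-! ### Sesquilinear forms and the Chern curvature of a matrix of functions -/

section SesqForm

variable {m : ℕ}

/-- The sesquilinear form `∑ cᵢ c̄'ⱼ Aᵢⱼ` of a matrix. -/
def sesqForm (A : Matrix (Fin m) (Fin m) ℂ) (c c' : Fin m → ℂ) : ℂ :=
  ∑ i, ∑ j, c i * starRingEnd ℂ (c' j) * A i j

theorem sesqForm_eq (A : Matrix (Fin m) (Fin m) ℂ) (c c' : Fin m → ℂ) :
    sesqForm A c c' = c ⬝ᵥ (A *ᵥ star c') := by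
  simp only [sesqForm, dotProduct, mulVec, Finset.mul_sum, Pi.star_apply]
  refine Finset.sum_congr rfl fun i _ => Finset.sum_congr rfl fun j _ => ?_
  rw [starRingEnd_apply]; ring

theorem sesqForm_add_left (A : Matrix (Fin m) (Fin m) ℂ) (x x' y : Fin m → ℂ) :
    sesqForm A (x + x') y = sesqForm A x y + sesqForm A x' y := by
  simp [sesqForm_eq, add_dotProduct]

theorem sesqForm_add_right (A : Matrix (Fin m) (Fin m) ℂ) (x y y' : Fin m → ℂ) :
    sesqForm A x (y + y') = sesqForm A x y + sesqForm A x y' := by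
  simp [sesqForm_eq, mulVec_add, dotProduct_add]

theorem sesqForm_vecMul_left (A B : Matrix (Fin m) (Fin m) ℂ) (x y : Fin m → ℂ) :
    sesqForm A (x ᵥ* B) y = sesqForm (B * A) x y := by
  simp only [sesqForm_eq]
  rw [← mulVec_mulVec, ← dotProduct_mulVec]

theorem sesqForm_vecMul_right (A B : Matrix (Fin m) (Fin m) ℂ) (x y : Fin m → ℂ) :
    sesqForm A x (y ᵥ* B) = sesqForm (A * Bᴴ) x y := by
  simp only [sesqForm_eq, star_vecMul, mulVec_mulVec]

end SesqForm

section Curvature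

variable {m : ℕ}

theorem dz_congr {G₁ G₂ : Cn m → ℂ} {z : Cn m} (h : G₁ =ᶠ[𝓝 z] G₂) (i : Fin m) :
    dz i G₁ z = dz i G₂ z := by
  rw [dz, dz, h.fderiv_eq]

/-- The components of the Chern curvature tensor of a Hermitian matrix valued function. -/
def curvComp (A : Cn m → Matrix (Fin m) (Fin m) ℂ) (z : Cn m) (i j k l : Fin m) : ℂ :=
  - dz i (dzbar j fun w => A w k l) z
    + ∑ p, ∑ q, (A z)⁻¹ q p * dz i (fun w => A w k q) z * dzbar j (fun w => A w p l) z

/-- The Chern curvature tensor of a Hermitian matrix valued function. -/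
def curv (A : Cn m → Matrix (Fin m) (Fin m) ℂ) (z : Cn m) (u v w y : Fin m → ℂ) : ℂ :=
  ∑ i, ∑ j, ∑ k, ∑ l, curvComp A z i j k l
    * u i * starRingEnd ℂ (v j) * w k * starRingEnd ℂ (y l)

/-- The derivative `∂_v A` of type `(1, 0)`. -/
def dzMatrix (A : Cn m → Matrix (Fin m) (Fin m) ℂ) (z : Cn m) (v : Fin m → ℂ) :
    Matrix (Fin m) (Fin m) ℂ :=
  Matrix.of fun k l => ∑ i, dz i (fun w => A w k l) z * v i

/-- The derivative `∂̄_v A` of type `(0, 1)`. -/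
def dzbarMatrix (A : Cn m → Matrix (Fin m) (Fin m) ℂ) (z : Cn m) (v : Fin m → ℂ) :
    Matrix (Fin m) (Fin m) ℂ :=
  Matrix.of fun k l => ∑ i, dzbar i (fun w => A w k l) z * starRingEnd ℂ (v i)

/-- The Levi form of `A` in direction `v`. -/
def leviMatrix (A : Cn m → Matrix (Fin m) (Fin m) ℂ) (z : Cn m) (v : Fin m → ℂ) :
    Matrix (Fin m) (Fin m) ℂ :=
  Matrix.of fun k l => ∑ i, ∑ j, dz i (dzbar j fun w => A w k l) z * v i * starRingEnd ℂ (v j)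

/-- The Chern connection form in direction `v`. -/
def connMatrix (A : Cn m → Matrix (Fin m) (Fin m) ℂ) (z : Cn m) (v : Fin m → ℂ) :
    Matrix (Fin m) (Fin m) ℂ :=
  dzMatrix A z v * (A z)⁻¹

theorem sum_sum_comm_sum_sum {ι κ R : Type*} [Fintype ι] [Fintype κ] [AddCommMonoid R]
    (F : ι → ι → κ → κ → R) :
    ∑ i, ∑ j, ∑ k, ∑ l, F i j k l = ∑ k, ∑ l, ∑ i, ∑ j, F i j k l := by
  rw [Finset.sum_congr rfl fun i _ => Finset.sum_comm, Finset.sum_comm]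
  refine Finset.sum_congr rfl fun k _ => ?_
  rw [Finset.sum_congr rfl fun i _ => Finset.sum_comm, Finset.sum_comm]

/-- Contracting the first two slots with `v` turns the index formula into `-∂∂̄A + ∂A · A⁻¹ · ∂̄A`,
the shape in which the curvature appears as the defect when a square is completed. -/
theorem curv_eq_sesqForm (A : Cn m → Matrix (Fin m) (Fin m) ℂ) (z : Cn m) (v x y : Fin m → ℂ) :
    curv A z v v x y
      = sesqForm (-leviMatrix A z v + dzMatrix A z v * (A z)⁻¹ * dzbarMatrix A z v) x y := by
  have h : ∀ k l, (-leviMatrix A z v + dzMatrix A z v * (A z)⁻¹ * dzbarMatrix A z v) k l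
      = ∑ i, ∑ j, curvComp A z i j k l * v i * starRingEnd ℂ (v j) := by
    intro k l
    have e : (dzMatrix A z v * (A z)⁻¹ * dzbarMatrix A z v) k l
        = ∑ i, ∑ j, (∑ p, ∑ q, (A z)⁻¹ q p * dz i (fun w => A w k q) z
          * dzbar j (fun w => A w p l) z) * v i * starRingEnd ℂ (v j) := by
      simp only [Matrix.mul_apply, dzMatrix, dzbarMatrix, Matrix.of_apply, Finset.sum_mul,
        Finset.mul_sum]
      conv_rhs => rw [sum_sum_comm_sum_sum]
      refine Finset.sum_congr rfl fun p _ => ?_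
      rw [Finset.sum_comm]
      refine Finset.sum_congr rfl fun q _ => ?_
      rw [Finset.sum_comm]
      refine Finset.sum_congr rfl fun i _ => Finset.sum_congr rfl fun j _ => ?_
      ring
    rw [Matrix.add_apply, e, Matrix.neg_apply, leviMatrix, Matrix.of_apply]
    simp only [curvComp, add_mul, Finset.sum_add_distrib, neg_mul, Finset.sum_neg_distrib]
  simp only [sesqForm, h, curv, Finset.mul_sum]
  rw [sum_sum_comm_sum_sum]
  refine Finset.sum_congr rfl fun k _ => Finset.sum_congr rfl fun l _ =>
    Finset.sum_congr rfl fun i _ => Finset.sum_congr rfl fun j _ => ?_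
  ring

theorem dzMatrix_conjTranspose {A : Cn m → Matrix (Fin m) (Fin m) ℂ} {z : Cn m}
    (hA : ∀ k l, DifferentiableAt ℝ (fun w => A w k l) z)
    (hherm : ∀ᶠ w in 𝓝 z, (A w).IsHermitian) (v : Fin m → ℂ) :
    (dzMatrix A z v)ᴴ = dzbarMatrix A z v := by
  ext k l
  have h : ∀ i, dz i (fun w => A w l k) z = starRingEnd ℂ (dzbar i (fun w => A w k l) z) := by
    intro i
    rw [← dz_conj (hA k l)]
    refine dz_congr ?_ i
    filter_upwards [hherm] with w hw
    exact (hw.apply l k).symm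
  simp [dzMatrix, dzbarMatrix, h]

/-- The second order expansion of the inner product of two holomorphic vector fields along a
holomorphic curve. -/
theorem HasJet.sesqForm_comp {A : Cn m → Matrix (Fin m) (Fin m) ℂ} {γ : ℂ → Cn m}
    {v : Fin m → ℂ} {X Y : ℂ → Fin m → ℂ} {x x' y y' : Fin m → ℂ} {z : Cn m} (hz : γ 0 = z)
    (hA : ∀ k l, ContDiffAt ℝ 2 (fun w => A w k l) z)
    (hherm : ∀ᶠ w in 𝓝 z, (A w).IsHermitian) (hunit : IsUnit (A z).det)
    (hc : ContinuousAt γ 0) (hγ : ∀ i, HasJet (fun t => γ t i) (z i) (v i) 0 0)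
    (hX : ∀ i, HasJet (fun t => X t i) (x i) (x' i) 0 0)
    (hY : ∀ i, HasJet (fun t => Y t i) (y i) (y' i) 0 0) :
    HasJet (fun t => sesqForm (A (γ t)) (X t) (Y t)) (sesqForm (A z) x y)
      (sesqForm (A z) (x' + x ᵥ* connMatrix A z v) y)
      (sesqForm (A z) x (y' + y ᵥ* connMatrix A z v))
      (sesqForm (A z) (x' + x ᵥ* connMatrix A z v) (y' + y ᵥ* connMatrix A z v)
        - curv A z v v x y) := by
  subst hz
  set z := γ 0
  have hPH := dzMatrix_conjTranspose (fun k l => (hA k l).differentiableAt (by simp)) hherm v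
  have hAH : (A z)ᴴ = A z := hherm.self_of_nhds
  -- With `Γ` the connection matrix, `Γ A = ∂A` and `A Γᴴ = ∂̄A`. Hence the first order terms are
  -- pairings with covariant derivatives `x' + xΓ`. The mixed term is the pairing of two of these,
  -- with `Γ A Γᴴ = ∂A · A⁻¹ · ∂̄A` in excess; together with the Levi form this excess makes up
  -- `-R`.
  have h1 : connMatrix A z v * A z = dzMatrix A z v := by
    rw [connMatrix, Matrix.mul_assoc, Matrix.nonsing_inv_mul _ hunit, Matrix.mul_one]
  have h2 : A z * (connMatrix A z v)ᴴ = dzbarMatrix A z v := by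
    rw [← hPH, ← h1, conjTranspose_mul, hAH]
  have h3 : dzMatrix A z v * (connMatrix A z v)ᴴ
      = dzMatrix A z v * (A z)⁻¹ * dzbarMatrix A z v := by
    rw [connMatrix, conjTranspose_mul, conjTranspose_nonsing_inv, hAH, hPH, Matrix.mul_assoc]
  have key := HasJet.sum Finset.univ fun i _ => HasJet.sum Finset.univ fun j _ =>
    ((hX i).mul (hY j).conj).mul (HasJet.comp_curve (hA i j) hc hγ)
  refine (key.congr (Eventually.of_forall fun t => rfl)).cast rfl ?_ ?_ ?_
  · rw [sesqForm_add_left, sesqForm_vecMul_left, h1]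
    simp only [sesqForm, ← Finset.sum_add_distrib]
    refine Finset.sum_congr rfl fun i _ => Finset.sum_congr rfl fun j _ => ?_
    simp only [map_zero, dzMatrix, of_apply]
    ring
  · rw [sesqForm_add_right, sesqForm_vecMul_right, h2]
    simp only [sesqForm, ← Finset.sum_add_distrib]
    refine Finset.sum_congr rfl fun i _ => Finset.sum_congr rfl fun j _ => ?_
    simp only [dzbarMatrix, of_apply]
    ring
  · rw [curv_eq_sesqForm, sesqForm_add_left, sesqForm_add_right, sesqForm_add_right,
      sesqForm_vecMul_left, sesqForm_vecMul_right, sesqForm_vecMul_left, h1, h2,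
      sesqForm_vecMul_right, h3]
    simp only [sesqForm, ← Finset.sum_add_distrib, ← Finset.sum_sub_distrib]
    refine Finset.sum_congr rfl fun i _ => Finset.sum_congr rfl fun j _ => ?_
    simp only [map_zero, Matrix.add_apply, Matrix.neg_apply]
    simp only [dzMatrix, dzbarMatrix, leviMatrix, of_apply]
    ring

end Curvature

/-! ### Orthonormal families and singular values -/

section InnerProduct

variable {E F : Type*} [NormedAddCommGroup E] [InnerProductSpace ℂ E] [FiniteDimensional ℂ E]
  [NormedAddCommGroup F] [InnerProductSpace ℂ F] [FiniteDimensional ℂ F]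

/-- A family of `l` vectors is contained in the span of an orthonormal family of `l` vectors. -/
theorem exists_orthonormal_span {m l : ℕ} (hm : Module.finrank ℂ E = m) (hl : l ≤ m)
    (v : Fin l → E) :
    ∃ u : Fin l → E, Orthonormal ℂ u ∧ ∃ C : Matrix (Fin l) (Fin l) ℂ,
      ∀ i, v i = ∑ a, C i a • u a := by
  -- Padding by zeros lets Gram–Schmidt return a full orthonormal basis even when the `vᵢ` are
  -- dependent. Triangularity then places each `vᵢ` in the span of the first `l` basis vectors.
  let f : Fin m → E := fun i => if h : (i : ℕ) < l then v ⟨i, h⟩ else 0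
  have hcard : Module.finrank ℂ E = Fintype.card (Fin m) := by simp [hm]
  let b := InnerProductSpace.gramSchmidtOrthonormalBasis hcard f
  have hinj : Function.Injective (Fin.castLE hl) := Fin.castLE_injective hl
  refine ⟨fun a => b (Fin.castLE hl a), b.orthonormal.comp _ hinj,
    Matrix.of fun i a => inner ℂ (b (Fin.castLE hl a)) (v i), fun i => ?_⟩
  have hf : f (Fin.castLE hl i) = v i := by simp [f]
  conv_lhs => rw [← b.sum_repr (v i)]
  simp only [b.repr_apply_apply, Matrix.of_apply]
  symm
  refine Finset.sum_of_injOn (Fin.castLE hl) hinj.injOn (by simp) ?_ (fun _ _ => rfl)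
  intro j _ hj
  have hlt : Fin.castLE hl i < j := by
    by_contra hcon
    refine hj ⟨⟨j, ?_⟩, by simp, by ext; simp⟩
    have : (j : ℕ) ≤ i := not_lt.1 hcon
    omega
  rw [← hf, InnerProductSpace.gramSchmidtOrthonormalBasis_inv_triangular hcard f hlt, zero_smul]

/-- Pairwise orthogonal vectors are multiples of the vectors of an orthonormal basis. -/
theorem exists_orthonormal_of_orthogonal {m : ℕ} (hm : Module.finrank ℂ E = m) (v : Fin m → E)
    (hv : Pairwise fun i j => inner ℂ (v i) (v j) = 0) :
    ∃ b : Fin m → E, Orthonormal ℂ b ∧ ∀ i, v i = (‖v i‖ : ℂ) • b i := by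
  have hcard : Module.finrank ℂ E = Fintype.card (Fin m) := by simp [hm]
  refine ⟨_, (InnerProductSpace.gramSchmidtOrthonormalBasis hcard v).orthonormal, fun i => ?_⟩
  by_cases hi : v i = 0
  · simp [hi]
  · rw [InnerProductSpace.gramSchmidtOrthonormalBasis_apply_of_orthogonal hcard hv hi, smul_smul]
    have : (‖v i‖ : ℂ) ≠ 0 := by simpa using hi
    simp [this]

/-- The sum of the squares of the first singular values is attained at an orthonormal family. -/
theorem exists_orthonormal_sum_singularValues {m l : ℕ} (hm : Module.finrank ℂ E = m)
    (hl : l ≤ m) (L : E →ₗ[ℂ] F) :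
    ∃ u : Fin l → E, Orthonormal ℂ u ∧
      ∑ a ∈ Finset.range l, L.singularValues a ^ 2 = ∑ i, (inner ℂ (L (u i)) (L (u i))).re := by
  have hS := L.isSymmetric_adjoint_comp_self
  let b := hS.eigenvectorBasis hm
  refine ⟨fun a => b (Fin.castLE hl a), b.orthonormal.comp _ (Fin.castLE_injective hl), ?_⟩
  rw [← Fin.sum_univ_eq_sum_range (fun a => L.singularValues a ^ 2)]
  refine Finset.sum_congr rfl fun i _ => ?_
  have h1 := L.sq_singularValues_fin hm (Fin.castLE hl i)
  have h2 := hS.apply_eigenvectorBasis hm (Fin.castLE hl i)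
  rw [Fin.val_castLE] at h1
  rw [h1, ← LinearMap.adjoint_inner_right, ← LinearMap.comp_apply, h2, inner_smul_right]
  change _ = (_ * inner ℂ (b _) (b _)).re
  rw [inner_self_eq_norm_sq_to_K, b.orthonormal.1]
  simp

end InnerProduct

theorem exists_unitary_sum_singularValuesOf {V W : Type*} [AddCommGroup V] [Module ℂ V]
    [FiniteDimensional ℂ V] [AddCommGroup W] [Module ℂ W] [FiniteDimensional ℂ W]
    (cV : InnerProductSpace.Core ℂ V) (cW : InnerProductSpace.Core ℂ W) {m l : ℕ}
    (hm : Module.finrank ℂ V = m) (hl : l ≤ m) (L : V →ₗ[ℂ] W) :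
    ∃ u : Fin l → V, (∀ i j, cV.inner (u i) (u j) = if i = j then 1 else 0) ∧
      ∑ a ∈ Finset.range l, singularValuesOf cV cW L a ^ 2
        = ∑ i, (cW.inner (L (u i)) (L (u i))).re := by
  let _ : NormedAddCommGroup V := cV.toNormedAddCommGroup
  let _ : InnerProductSpace ℂ V := InnerProductSpace.ofCore cV.toCore
  let _ : NormedAddCommGroup W := cW.toNormedAddCommGroup
  let _ : InnerProductSpace ℂ W := InnerProductSpace.ofCore cW.toCore
  obtain ⟨u, hu, hs⟩ := exists_orthonormal_sum_singularValues hm hl L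
  exact ⟨u, orthonormal_iff_ite.1 hu, hs⟩

namespace HermitianMetric

variable {m : ℕ} {M : Type*} [TopologicalSpace M] [ChartedSpace (Cn m) M]
  (g : HermitianMetric m M) {x : M}

theorem finrank_tangent (x : M) : Module.finrank ℂ (T m x) = m :=
  (finrank_euclideanSpace (𝕜 := ℂ) (ι := Fin m)).trans (Fintype.card_fin m)

instance instFiniteDimensionalT (x : M) : FiniteDimensional ℂ (T m x) := inferInstanceAs (FiniteDimensional ℂ (Cn m))

theorem exists_isUnitary_span {l : ℕ} (hl : l ≤ m) (v : Fin l → T m x) :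
    ∃ u : Fin l → T m x, g.IsUnitary x u ∧ ∃ C : Matrix (Fin l) (Fin l) ℂ,
      ∀ i, v i = ∑ a, C i a • u a := by
  let _ : NormedAddCommGroup (T m x) := (g.core x).toNormedAddCommGroup
  let _ : InnerProductSpace ℂ (T m x) := InnerProductSpace.ofCore (g.core x).toCore
  obtain ⟨u, hu, C, hC⟩ := exists_orthonormal_span (finrank_tangent x) hl v
  refine ⟨u, fun i j => ?_, C, hC⟩
  -- The indices are exchanged because `core` reverses the arguments of the metric.
  have := orthonormal_iff_ite.1 hu j i
  simp only [eq_comm (a := j)] at this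
  exact this

theorem IsUnitary.orthonormal {l : ℕ} {e : Fin l → T m x} (he : g.IsUnitary x e) :
    letI : NormedAddCommGroup (T m x) := (g.core x).toNormedAddCommGroup
    letI : InnerProductSpace ℂ (T m x) := InnerProductSpace.ofCore (g.core x).toCore
    Orthonormal ℂ e := by
  let _ : NormedAddCommGroup (T m x) := (g.core x).toNormedAddCommGroup
  let _ : InnerProductSpace ℂ (T m x) := InnerProductSpace.ofCore (g.core x).toCore
  refine orthonormal_iff_ite.2 fun i j => ?_
  simp only [eq_comm (a := i)]
  exact he j i

theorem exists_isUnitary_of_orthogonal (v : Fin m → T m x)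
    (hv : ∀ i j, i ≠ j → g.inner x (v i) (v j) = 0) :
    ∃ b : Fin m → T m x, g.IsUnitary x b ∧
      ∀ i, v i = (√(g.inner x (v i) (v i)).re : ℂ) • b i := by
  let _ : NormedAddCommGroup (T m x) := (g.core x).toNormedAddCommGroup
  let _ : InnerProductSpace ℂ (T m x) := InnerProductSpace.ofCore (g.core x).toCore
  obtain ⟨b, hb, hvb⟩ := exists_orthonormal_of_orthogonal (finrank_tangent x) v
    (fun i j hij => hv j i hij.symm)
  refine ⟨b, fun i j => ?_, hvb⟩
  have := orthonormal_iff_ite.1 hb j i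
  simp only [eq_comm (a := j)] at this
  exact this

/-- Bessel's inequality. It absorbs the negative term `-tr (B Bᴴ)` in the expansion of the
determinant. -/
theorem sum_normSq_inner_le {l : ℕ} {e : Fin l → T m x} (he : g.IsUnitary x e) (v : T m x) :
    ∑ j, Complex.normSq (g.inner x v (e j)) ≤ (g.inner x v v).re := by
  let _ : NormedAddCommGroup (T m x) := (g.core x).toNormedAddCommGroup
  let _ : InnerProductSpace ℂ (T m x) := InnerProductSpace.ofCore (g.core x).toCore
  have h := (he.orthonormal g).sum_inner_products_le (x := v) (s := Finset.univ)
  rw [← inner_self_eq_norm_sq (𝕜 := ℂ)] at h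
  simp only [Complex.normSq_eq_norm_sq]
  exact h

theorem IsUnitary.linearIndependent {l : ℕ} {e : Fin l → T m x} (he : g.IsUnitary x e) :
    LinearIndependent ℂ e := by
  let _ : NormedAddCommGroup (T m x) := (g.core x).toNormedAddCommGroup
  let _ : InnerProductSpace ℂ (T m x) := InnerProductSpace.ofCore (g.core x).toCore
  exact (he.orthonormal g).linearIndependent

theorem IsUnitary.finrank_span {l : ℕ} {e : Fin l → T m x} (he : g.IsUnitary x e) :
    Module.finrank ℂ (Submodule.span ℂ (Set.range e)) = l := by
  rw [finrank_span_eq_card (he.linearIndependent g), Fintype.card_fin]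

theorem re_inner_self_nonneg (v : T m x) : 0 ≤ (g.inner x v v).re :=
  (g.core x).re_inner_nonneg v

end HermitianMetric

theorem exists_isUnitary_sigma {m n : ℕ} {M N : Type*} [TopologicalSpace M]
    [ChartedSpace (Cn m) M] [TopologicalSpace N] [ChartedSpace (Cn n) N]
    (g : HermitianMetric m M) (h : HermitianMetric n N) (f : M → N) {l : ℕ} (hl : l ≤ m) (x : M) :
    ∃ u : Fin l → T m x, g.IsUnitary x u ∧
      sigma g h f l x = ∑ i, (h.inner (f x) (tmap f x (u i)) (tmap f x (u i))).re := by
  have : FiniteDimensional ℂ (T n (f x)) := HermitianMetric.instFiniteDimensionalT (f x)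
  obtain ⟨u, hu, hs⟩ := exists_unitary_sum_singularValuesOf (g.core x) (h.core (f x))
    (HermitianMetric.finrank_tangent x) hl (tmap f x)
  refine ⟨u, fun i j => ?_, hs⟩
  have := hu j i
  simp only [eq_comm (a := j)] at this
  exact this

/-! ### Gram matrices of two Hermitian forms -/

section Gram

variable {V : Type*} [AddCommGroup V] [Module ℂ V] {l : ℕ}

/-- The Gram matrix of a family of vectors. -/
def gram (B : V →ₗ[ℂ] V →ₗ⋆[ℂ] ℂ) (v : Fin l → V) : Matrix (Fin l) (Fin l) ℂ :=
  Matrix.of fun i j => B (v i) (v j)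

theorem gram_sum_smul (B : V →ₗ[ℂ] V →ₗ⋆[ℂ] ℂ) (C : Matrix (Fin l) (Fin l) ℂ) (u : Fin l → V) :
    gram B (fun i => ∑ a, C i a • u a) = C * gram B u * Cᴴ := by
  ext i j
  simp only [gram, of_apply, map_sum, map_smul, LinearMap.sum_apply, LinearMap.smul_apply,
    map_smulₛₗ, smul_eq_mul, Matrix.mul_apply, conjTranspose_apply, Finset.sum_mul]
  refine Finset.sum_congr rfl fun a _ => ?_
  rw [Finset.mul_sum]
  refine Finset.sum_congr rfl fun b _ => ?_
  rw [starRingEnd_apply]; ring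

/-- The factor `|det C|²` does not depend on the form. It cancels in quotients, which are thus
determined by their value on a unitary family. -/
theorem gram_det_eq (B : V →ₗ[ℂ] V →ₗ⋆[ℂ] ℂ) {v u : Fin l → V} {C : Matrix (Fin l) (Fin l) ℂ}
    (hv : ∀ i, v i = ∑ a, C i a • u a) :
    (gram B v).det = Complex.normSq C.det * (gram B u).det := by
  rw [funext hv, gram_sum_smul, det_mul, det_mul, det_conjTranspose, ← Complex.mul_conj,
    starRingEnd_apply]
  ring

variable {B G : V →ₗ[ℂ] V →ₗ⋆[ℂ] ℂ}

theorem gram_isHermitian (hB : ∀ u v, starRingEnd ℂ (B v u) = B u v) (v : Fin l → V) :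
    (gram B v).IsHermitian := by
  ext i j
  exact hB _ _

/-- If the Gram determinant is bounded on unitary families, it is bounded on all families. -/
theorem gram_det_re_le {c : ℝ} {v u : Fin l → V} {C : Matrix (Fin l) (Fin l) ℂ}
    (hv : ∀ i, v i = ∑ a, C i a • u a) (hu : gram G u = 1) (hc : (gram B u).det.re ≤ c) :
    (gram B v).det.re ≤ c * (gram G v).det.re := by
  rw [gram_det_eq B hv, gram_det_eq G hv, hu, det_one, mul_one, Complex.re_ofReal_mul,
    Complex.ofReal_re, mul_comm]
  exact mul_le_mul_of_nonneg_right hc (Complex.normSq_nonneg _)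

/-- Comparison of the trace of a Gram matrix, corrected to first order, with its trace on a unitary
family. -/
theorem gram_trace_re_le (hB : ∀ v, 0 ≤ (B v v).re) {v u : Fin l → V}
    {C : Matrix (Fin l) (Fin l) ℂ} (hv : ∀ i, v i = ∑ a, C i a • u a) (hu : gram G u = 1) :
    (gram B v * (2 - gram G v)).trace.re ≤ (gram B u).trace.re := by
  rw [funext hv, gram_sum_smul, gram_sum_smul, hu]
  -- The two traces differ by exactly the `B`-trace of the family `(1 - CᴴC)u`, which is
  -- nonnegative. Here `2 - gram G v` replaces the inverse of `gram G v`, with which it agrees to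
  -- first order at the identity.
  have key : (gram B fun i => ∑ a, (1 - Cᴴ * C) i a • u a).trace.re
      = (gram B u).trace.re - (C * gram B u * Cᴴ * (2 - C * 1 * Cᴴ)).trace.re := by
    rw [gram_sum_smul, ← Complex.sub_re, ← Matrix.trace_sub]
    congr 1
    have hP : (1 - Cᴴ * C)ᴴ = 1 - Cᴴ * C := by simp
    rw [hP, Matrix.trace_mul_comm, ← Matrix.mul_assoc]
    have e : (C * gram B u * Cᴴ * (2 - C * 1 * Cᴴ)).trace
        = ((2 * (Cᴴ * C) - Cᴴ * C * (Cᴴ * C)) * gram B u).trace := by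
      rw [Matrix.mul_assoc, Matrix.mul_assoc, Matrix.trace_mul_comm, Matrix.mul_assoc,
        Matrix.trace_mul_comm]
      congr 1
      noncomm_ring
    rw [Matrix.trace_sub, e, ← Matrix.trace_sub]
    congr 1
    noncomm_ring
  have hpos : 0 ≤ (gram B fun i => ∑ a, (1 - Cᴴ * C) i a • u a).trace.re := by
    rw [Matrix.trace, Complex.re_sum]
    exact Finset.sum_nonneg fun i _ => hB _
  linarith

/-- A unitary family can be rotated so that a second Hermitian form becomes diagonal. -/
theorem exists_gram_diagonal (hB : ∀ u v, starRingEnd ℂ (B v u) = B u v)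
    {u : Fin l → V} (hu : gram G u = 1) :
    ∃ (w : Fin l → V) (μ : Fin l → ℝ), gram G w = 1 ∧
      gram B w = Matrix.diagonal (fun i => (μ i : ℂ)) ∧
      (gram B w).det = (gram B u).det ∧ (gram B w).trace = (gram B u).trace := by
  have hH := gram_isHermitian hB u
  set U : Matrix (Fin l) (Fin l) ℂ := ↑hH.eigenvectorUnitary with hU
  have h1 : star U * U = 1 := Unitary.coe_star_mul_self _
  have h2 : U * star U = 1 := Unitary.coe_mul_star_self _
  obtain ⟨μ, hs⟩ : ∃ μ : Fin l → ℝ,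
      gram B u = U * diagonal (fun i => (μ i : ℂ)) * star U := by
    refine ⟨hH.eigenvalues, ?_⟩
    conv_lhs => rw [hH.spectral_theorem]
    rfl
  have hd : star U * gram B u * U = diagonal (fun i => (μ i : ℂ)) := by
    rw [hs, ← Matrix.mul_assoc, ← Matrix.mul_assoc, h1, Matrix.one_mul, Matrix.mul_assoc, h1,
      Matrix.mul_one]
  refine ⟨fun i => ∑ a, (star U) i a • u a, μ, ?_, ?_, ?_, ?_⟩
  · rw [gram_sum_smul, hu, Matrix.mul_one, star_eq_conjTranspose, conjTranspose_conjTranspose,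
      ← star_eq_conjTranspose, h1]
  · rw [gram_sum_smul, ← hd, star_eq_conjTranspose, conjTranspose_conjTranspose]
  · rw [gram_sum_smul, star_eq_conjTranspose, conjTranspose_conjTranspose, det_mul, det_mul,
      mul_right_comm, ← det_mul, ← star_eq_conjTranspose, h1, det_one, one_mul]
  · rw [gram_sum_smul, star_eq_conjTranspose, conjTranspose_conjTranspose, Matrix.trace_mul_comm,
      ← Matrix.mul_assoc, ← star_eq_conjTranspose, h2, Matrix.one_mul]

end Gram

/-! ### Metrics, tangent maps and `f*h` in charts -/

section Coordinates

variable {m n : ℕ} {M N : Type*} [TopologicalSpace M] [ChartedSpace (Cn m) M]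
  [TopologicalSpace N] [ChartedSpace (Cn n) N]

/-- The components of a tangent vector at `y` in the chart `φ`. -/
def coords (φ : OpenPartialHomeomorph M (Cn m)) (y : M) : T m y →ₗ[ℂ] Cn m :=
  (mfderiv 𝓘(ℂ, Cn m) 𝓘(ℂ, Cn m) φ y).toLinearMap

theorem HermitianMetric.matrix_isHermitian (g : HermitianMetric m M)
    (φ : OpenPartialHomeomorph M (Cn m)) (z : Cn m) : (g.matrix φ z).IsHermitian := by
  ext i j
  exact g.conj_symm _ _ _

theorem HermitianMetric.chern_eq_curv (g : HermitianMetric m M) (x : M) (u v w y : T m x) :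
    g.chern x u v w y = curv (g.matrix (chartAt (Cn m) x)) (chartAt (Cn m) x x)
      (coords (chartAt (Cn m) x) x u) (coords (chartAt (Cn m) x) x v)
      (coords (chartAt (Cn m) x) x w) (coords (chartAt (Cn m) x) x y) := rfl

theorem HermitianMetric.contDiffAt_matrix (g : HermitianMetric m M) {φ : OpenPartialHomeomorph M (Cn m)}
    (hφ : φ ∈ atlas (Cn m) M)
    {z : Cn m} (hz : z ∈ φ.target) (k l : Fin m) :
    ContDiffAt ℝ 2 (fun w => g.matrix φ w k l) z :=
  ((g.smooth φ hφ k l).contDiffAt (φ.open_target.mem_nhds hz)).of_le ENat.LEInfty.out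

section

variable [IsManifold 𝓘(ℂ, Cn m) 1 M] {φ : OpenPartialHomeomorph M (Cn m)}

theorem coords_bijective (hφ : φ ∈ atlas (Cn m) M) {y : M} (hy : y ∈ φ.source) :
    Function.Bijective (coords φ y) :=
  (mdifferentiable_of_mem_atlas (I := 𝓘(ℂ, Cn m)) hφ).mfderiv_bijective hy

theorem coords_coordVec (hφ : φ ∈ atlas (Cn m) M) {z : Cn m} (hz : z ∈ φ.target) (i : Fin m) :
    coords φ (φ.symm z) (coordVec φ z i) = EuclideanSpace.single i (1 : ℂ) := by
  have h := (mdifferentiable_of_mem_atlas (I := 𝓘(ℂ, Cn m)) hφ).comp_symm_deriv hz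
  exact congrArg (fun L => L (EuclideanSpace.single i (1 : ℂ) : Cn m)) h

theorem eq_sum_coordVec (hφ : φ ∈ atlas (Cn m) M) {z : Cn m} (hz : z ∈ φ.target)
    (u : T m (φ.symm z)) :
    u = ∑ i, coords φ (φ.symm z) u i • coordVec φ z i := by
  refine (coords_bijective hφ (φ.map_target hz)).1 ?_
  simp only [map_sum, map_smul, coords_coordVec hφ hz]
  ext j
  simp [Pi.single_apply]

theorem HermitianMetric.inner_eq_sesqForm (g : HermitianMetric m M) (hφ : φ ∈ atlas (Cn m) M)
    {y : M} (hy : y ∈ φ.source) (u w : T m y) :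
    g.inner y u w = sesqForm (g.matrix φ (φ y)) (coords φ y u) (coords φ y w) := by
  obtain ⟨z, hz, rfl⟩ : ∃ z ∈ φ.target, φ.symm z = y := ⟨φ y, φ.map_source hy, φ.left_inv hy⟩
  rw [φ.right_inv hz]
  conv_lhs => rw [eq_sum_coordVec hφ hz u, eq_sum_coordVec hφ hz w]
  simp only [map_sum, map_smul, LinearMap.sum_apply, LinearMap.smul_apply, map_smulₛₗ, smul_eq_mul,
    sesqForm, HermitianMetric.matrix, Matrix.of_apply]
  simp only [Finset.mul_sum]
  rw [Finset.sum_comm]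
  refine Finset.sum_congr rfl fun i _ => Finset.sum_congr rfl fun j _ => ?_
  ring

theorem HermitianMetric.isUnit_det_matrix (g : HermitianMetric m M) (hφ : φ ∈ atlas (Cn m) M)
    {z : Cn m} (hz : z ∈ φ.target) : IsUnit (g.matrix φ z).det := by
  rw [isUnit_iff_ne_zero]
  intro h0
  obtain ⟨c, hc, h⟩ := Matrix.exists_vecMul_eq_zero_iff.2 h0
  have hy := φ.map_target hz
  obtain ⟨u, hu⟩ := (coords_bijective hφ hy).2 (WithLp.toLp 2 c)
  have hu0 : u ≠ 0 := by
    rintro rfl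
    apply hc
    rw [map_zero] at hu
    simpa using (congrArg WithLp.ofLp hu).symm
  have hpos := g.pos _ u hu0
  rw [g.inner_eq_sesqForm hφ hy, φ.right_inv hz, hu, sesqForm_eq, dotProduct_mulVec, h] at hpos
  simp at hpos

end

/-- The Hermitian form `f*h` on the tangent space at `x`. -/
def pullInner (h : HermitianMetric n N) (f : M → N) (x : M) : T m x →ₗ[ℂ] T m x →ₗ⋆[ℂ] ℂ :=
  LinearMap.mk₂'ₛₗ (RingHom.id ℂ) (starRingEnd ℂ)
    (fun u v => h.inner (f x) (tmap f x u) (tmap f x v)) (by simp) (by simp) (by simp) (by simp)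

theorem pullInner_apply (h : HermitianMetric n N) (f : M → N) (x : M) (u v : T m x) :
    pullInner h f x u v = h.inner (f x) (tmap f x u) (tmap f x v) := rfl

theorem pullInner_conj_symm (h : HermitianMetric n N) (f : M → N) (x : M) (u v : T m x) :
    starRingEnd ℂ (pullInner h f x v u) = pullInner h f x u v := h.conj_symm _ _ _

theorem re_pullInner_self_nonneg (h : HermitianMetric n N) (f : M → N) (x : M) (u : T m x) :
    0 ≤ (pullInner h f x u u).re := h.re_inner_self_nonneg _

variable [IsManifold 𝓘(ℂ, Cn m) ω M] [IsManifold 𝓘(ℂ, Cn n) ω N] {f : M → N}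
  {φ : OpenPartialHomeomorph M (Cn m)} {ψ : OpenPartialHomeomorph N (Cn n)}

theorem analyticAt_chart_expr (hf : ContMDiff 𝓘(ℂ, Cn m) 𝓘(ℂ, Cn n) ω f)
    (hφ : φ ∈ atlas (Cn m) M) (hψ : ψ ∈ atlas (Cn n) N) {z : Cn m} (hz : z ∈ φ.target)
    (hfz : f (φ.symm z) ∈ ψ.source) : AnalyticAt ℂ (fun w => ψ (f (φ.symm w))) z := by
  have h1 : ContMDiffAt 𝓘(ℂ, Cn m) 𝓘(ℂ, Cn m) ω φ.symm z :=
    contMDiffAt_symm_of_mem_maximalAtlas (IsManifold.subset_maximalAtlas hφ) hz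
  have h2 : ContMDiffAt 𝓘(ℂ, Cn n) 𝓘(ℂ, Cn n) ω ψ (f (φ.symm z)) :=
    contMDiffAt_of_mem_maximalAtlas (IsManifold.subset_maximalAtlas hψ) hfz
  have h3 : ContMDiffAt 𝓘(ℂ, Cn m) 𝓘(ℂ, Cn n) ω (fun w => ψ (f (φ.symm w))) z :=
    h2.comp z ((hf _).comp z h1)
  exact h3.contDiffAt.analyticAt

theorem coords_tmap (hf : ContMDiff 𝓘(ℂ, Cn m) 𝓘(ℂ, Cn n) ω f)
    (hφ : φ ∈ atlas (Cn m) M) (hψ : ψ ∈ atlas (Cn n) N) {y : M} (hy : y ∈ φ.source)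
    (hfy : f y ∈ ψ.source) (u : T m y) :
    coords ψ (f y) (tmap f y u)
      = fderiv ℂ (fun w => ψ (f (φ.symm w))) (φ y) (coords φ y u) := by
  have : IsManifold 𝓘(ℂ, Cn m) 1 M := IsManifold.of_le (n := ω) le_top
  have : IsManifold 𝓘(ℂ, Cn n) 1 N := IsManifold.of_le (n := ω) le_top
  have hF := (analyticAt_chart_expr hf hφ hψ (φ.map_source hy)
    (by rwa [φ.left_inv hy])).differentiableAt
  have dφ := (mdifferentiable_of_mem_atlas (I := 𝓘(ℂ, Cn m)) hφ).mdifferentiableAt hy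
  have dψ := (mdifferentiable_of_mem_atlas (I := 𝓘(ℂ, Cn n)) hψ).mdifferentiableAt hfy
  have df : MDifferentiableAt 𝓘(ℂ, Cn m) 𝓘(ℂ, Cn n) f y := (hf y).mdifferentiableAt (by simp)
  have e : (ψ ∘ f) =ᶠ[𝓝 y] (fun w => ψ (f (φ.symm w))) ∘ φ := by
    filter_upwards [φ.open_source.mem_nhds hy] with y' hy'
    simp [φ.left_inv hy']
  have h1 := mfderiv_comp y dψ df
  have h2 := mfderiv_comp y hF.mdifferentiableAt dφ
  rw [e.mfderiv_eq, h2] at h1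
  have h3 := congrArg (fun L => L u) h1.symm
  rw [mfderiv_eq_fderiv] at h3
  exact h3

end Coordinates

/-! ### Holomorphic extension of a frame along a disc -/

section FrameCurve

variable {m n : ℕ} {M N : Type*} [TopologicalSpace M] [ChartedSpace (Cn m) M]
  [IsManifold 𝓘(ℂ, Cn m) ω M]
  [TopologicalSpace N] [ChartedSpace (Cn n) N] [IsManifold 𝓘(ℂ, Cn n) ω N]

theorem hasJet_apply_of_analyticAt {k : ℕ} {u : ℂ → Cn k} (hu : AnalyticAt ℂ u 0) (i : Fin k) :
    HasJet (fun t => u t i) (u 0 i) (deriv u 0 i) 0 0 := by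
  have h1 : AnalyticAt ℂ (fun t => u t i) 0 :=
    (EuclideanSpace.proj (𝕜 := ℂ) i : Cn k →L[ℂ] ℂ).analyticAt _ |>.comp hu
  refine (HasJet.of_analyticAt h1).cast rfl ?_ rfl rfl
  exact ((EuclideanSpace.proj (𝕜 := ℂ) i : Cn k →L[ℂ] ℂ).hasFDerivAt.comp_hasDerivAt 0
    hu.differentiableAt.hasDerivAt).deriv

/-- Vectors `e₁, …, e_l` at `x` extend holomorphically along a holomorphic disc through `x` in
direction `v`, with vanishing first covariant derivative at `x`. The expansions of the Gram
matrices for `g` and `f*h` along the disc involve the Chern curvatures. -/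
theorem exists_frame_curve (g : HermitianMetric m M) (h : HermitianMetric n N) {f : M → N}
    (hf : ContMDiff 𝓘(ℂ, Cn m) 𝓘(ℂ, Cn n) ω f) {l : ℕ} (x : M) (e : Fin l → T m x) (v : T m x) :
    ∃ (G H : ℂ → Matrix (Fin l) (Fin l) ℂ) (s : Fin l → T n (f x)),
      (∀ᶠ t in 𝓝 0, ∃ (y : M) (V : Fin l → T m y),
        G t = gram (g.inner y) V ∧ H t = gram (pullInner h f y) V) ∧
      (∀ i j, HasJet (fun t => G t i j) (g.inner x (e i) (e j)) 0 0
        (-g.chern x v v (e i) (e j))) ∧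
      (∀ i j, HasJet (fun t => H t i j) (pullInner h f x (e i) (e j))
        (h.inner (f x) (s i) (tmap f x (e j))) (h.inner (f x) (tmap f x (e i)) (s j))
        (h.inner (f x) (s i) (s j)
          - h.chern (f x) (tmap f x v) (tmap f x v) (tmap f x (e i)) (tmap f x (e j)))) := by
  have : IsManifold 𝓘(ℂ, Cn m) 1 M := IsManifold.of_le (n := ω) le_top
  have : IsManifold 𝓘(ℂ, Cn n) 1 N := IsManifold.of_le (n := ω) le_top
  set φ := chartAt (Cn m) x with hφdef
  set ψ := chartAt (Cn n) (f x) with hψdef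
  have hφ : φ ∈ atlas (Cn m) M := chart_mem_atlas _ _
  have hψ : ψ ∈ atlas (Cn n) N := chart_mem_atlas _ _
  have hx : x ∈ φ.source := mem_chart_source _ _
  have hfx : f x ∈ ψ.source := mem_chart_source _ _
  set z := φ x with hzdef
  have hz : z ∈ φ.target := φ.map_source hx
  have hzx : φ.symm z = x := φ.left_inv hx
  set F : Cn m → Cn n := fun w => ψ (f (φ.symm w)) with hFdef
  have hF : AnalyticAt ℂ F z := analyticAt_chart_expr hf hφ hψ hz (by rwa [hzx])
  have hFz : F z = ψ (f x) := by rw [hFdef]; simp only [hzx]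
  set a : Cn m := coords φ x v with ha
  set c : Fin l → Cn m := fun i => coords φ x (e i) with hc
  -- The velocity is chosen so that the covariant derivative `d + cΓ` of the field `c + t d`
  -- vanishes at `t = 0`.
  set d : Fin l → Cn m := fun i => WithLp.toLp 2 (-((c i : Fin m → ℂ) ᵥ* connMatrix (g.matrix φ) z a))
    with hd
  set γ : ℂ → Cn m := fun t => z + t • a with hγ
  set X : Fin l → ℂ → Cn m := fun i t => c i + t • d i with hX
  set S : Fin l → ℂ → Cn n := fun i t => fderiv ℂ F (γ t) (X i t) with hS
  have hγ0 : γ 0 = z := by simp [hγ]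
  have hγa : AnalyticAt ℂ γ 0 := by fun_prop
  have hXa : ∀ i, AnalyticAt ℂ (X i) 0 := fun i => by fun_prop
  have hγd : HasDerivAt γ a 0 := by
    have h1 := ((hasDerivAt_id (0 : ℂ)).smul_const a).const_add z
    rwa [one_smul] at h1
  have hXd : ∀ i, deriv (X i) 0 = d i := fun i => by
    have : HasDerivAt (X i) ((1 : ℂ) • d i) 0 :=
      ((hasDerivAt_id (0 : ℂ)).smul_const (d i)).const_add (c i)
    simpa using this.deriv
  have hX0 : ∀ i, X i 0 = c i := fun i => by simp [hX]
  have hSa : ∀ i, AnalyticAt ℂ (S i) 0 := fun i => by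
    have h1 : AnalyticAt ℂ (fun t => fderiv ℂ F (γ t)) 0 :=
      AnalyticAt.fun_comp (by rw [hγ0]; exact hF.fderiv) hγa
    exact ((ContinuousLinearMap.id ℂ (Cn m →L[ℂ] Cn n)).analyticAt_bilinear _).comp₂ h1 (hXa i)
  have hS0 : ∀ i, S i 0 = coords ψ (f x) (tmap f x (e i)) := fun i => by
    rw [coords_tmap hf hφ hψ hx hfx, hS]
    simp only [hγ0, hX0]
    rfl
  have hFγ : AnalyticAt ℂ (fun t => F (γ t)) 0 := AnalyticAt.fun_comp (by rwa [hγ0]) hγa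
  have hFγd : deriv (fun t => F (γ t)) 0 = coords ψ (f x) (tmap f x v) := by
    rw [coords_tmap hf hφ hψ hx hfx]
    have h1 : HasFDerivAt F (fderiv ℂ F z) (γ 0) := by
      rw [hγ0]; exact hF.differentiableAt.hasFDerivAt
    exact (h1.comp_hasDerivAt 0 hγd).deriv
  -- `sᵢ` is the covariant derivative at `t = 0`, for the Chern connection of `h` along the image
  -- disc, of the image `dF(Xᵢ)` of the extended field.
  choose s hs using fun i => (coords_bijective hψ hfx).2
    (deriv (S i) 0 + WithLp.toLp 2 ((S i 0 : Fin n → ℂ) ᵥ*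
      connMatrix (h.matrix ψ) (ψ (f x)) (coords ψ (f x) (tmap f x v))))
  refine ⟨fun t => Matrix.of fun i j => sesqForm (g.matrix φ (γ t)) (X i t) (X j t),
    fun t => Matrix.of fun i j => sesqForm (h.matrix ψ (F (γ t))) (S i t) (S j t), s, ?_, ?_, ?_⟩
  · have h1 : ∀ᶠ w in 𝓝 z, w ∈ φ.target := φ.open_target.mem_nhds hz
    have h2 : ∀ᶠ w in 𝓝 z, f (φ.symm w) ∈ ψ.source := by
      have hcont : ContinuousAt (fun w => f (φ.symm w)) z :=
        (hf.continuous.continuousAt).comp (φ.symm.continuousAt hz)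
      exact hcont.preimage_mem_nhds (ψ.open_source.mem_nhds (by rwa [hzx]))
    have hγt : Tendsto γ (𝓝 0) (𝓝 z) := by
      simpa [hγ0] using hγa.continuousAt.tendsto
    filter_upwards [hγt.eventually h1, hγt.eventually h2] with t ht1 ht2
    have hy := φ.map_target ht1
    choose V hV using fun i => (coords_bijective hφ hy).2 (X i t)
    refine ⟨φ.symm (γ t), V, ?_, ?_⟩
    · ext i j
      simp only [gram, of_apply, g.inner_eq_sesqForm hφ hy, hV, φ.right_inv ht1]
    · ext i j
      simp only [gram, of_apply, pullInner_apply, h.inner_eq_sesqForm hψ ht2,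
        coords_tmap hf hφ hψ hy ht2, hV, φ.right_inv ht1]
      rfl
  · intro i j
    have key := HasJet.sesqForm_comp (z := z) (v := a) (γ := γ) (A := g.matrix φ)
      (X := fun t => X i t) (Y := fun t => X j t)
      (x := c i) (y := c j) (x' := d i) (y' := d j) hγ0
      (fun k l => g.contDiffAt_matrix hφ hz k l)
      (Eventually.of_forall fun w => g.matrix_isHermitian φ w) (g.isUnit_det_matrix hφ hz)
      hγa.continuousAt
      (fun k => (hasJet_apply_of_analyticAt hγa k).cast (by rw [hγ0]) (by rw [hγd.deriv]) rfl rfl)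
      (fun k => (hasJet_apply_of_analyticAt (hXa i) k).cast (by rw [hX0]) (by rw [hXd]) rfl rfl)
      (fun k => (hasJet_apply_of_analyticAt (hXa j) k).cast (by rw [hX0]) (by rw [hXd]) rfl rfl)
    -- Both covariant derivatives vanish, so the terms in `t` and `t̄` disappear and only the
    -- curvature is left in the mixed term.
    have hz' : ∀ i, (d i : Fin m → ℂ) + (c i : Fin m → ℂ) ᵥ* connMatrix (g.matrix φ) z a = 0 :=
      fun i => neg_add_cancel _
    rw [hz', hz'] at key
    refine key.cast ?_ ?_ ?_ ?_
    · rw [g.inner_eq_sesqForm hφ hx]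
    · simp [sesqForm]
    · simp [sesqForm]
    · rw [g.chern_eq_curv]
      simp [sesqForm]
      rfl
  · intro i j
    have hw : ψ (f x) ∈ ψ.target := ψ.map_source hfx
    have hFγ0 : F (γ 0) = ψ (f x) := by rw [hγ0, hFz]
    have hj : ∀ k, HasJet (fun t => F (γ t) k) (ψ (f x) k) (coords ψ (f x) (tmap f x v) k) 0 0 := by
      intro k
      rw [← hFγd, ← hFγ0]
      exact hasJet_apply_of_analyticAt hFγ k
    have hjS : ∀ i k, HasJet (fun t => S i t k) (S i 0 k) (deriv (S i) 0 k) 0 0 :=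
      fun i k => hasJet_apply_of_analyticAt (hSa i) k
    have key := HasJet.sesqForm_comp (z := ψ (f x)) (v := coords ψ (f x) (tmap f x v))
      (γ := fun t => F (γ t)) (A := h.matrix ψ)
      (X := fun t => S i t) (Y := fun t => S j t)
      (x := S i 0) (y := S j 0) (x' := (deriv (S i) 0).ofLp) (y' := (deriv (S j) 0).ofLp)
      hFγ0 (fun k l => h.contDiffAt_matrix hψ hw k l)
      (Eventually.of_forall fun w => h.matrix_isHermitian ψ w) (h.isUnit_det_matrix hψ hw)
      hFγ.continuousAt hj (hjS i) (hjS j)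
    have hs' : ∀ i, (coords ψ (f x) (s i) : Fin n → ℂ) = (deriv (S i) 0).ofLp +
      (S i 0 : Fin n → ℂ) ᵥ* connMatrix (h.matrix ψ) (ψ (f x)) (coords ψ (f x) (tmap f x v)) :=
      fun i => congrArg WithLp.ofLp (hs i)
    rw [← hs', ← hs', hS0, hS0, ← h.inner_eq_sesqForm hψ hfx, ← h.inner_eq_sesqForm hψ hfx,
      ← h.inner_eq_sesqForm hψ hfx, ← h.inner_eq_sesqForm hψ hfx] at key
    exact key

end FrameCurve

/-! ### Compactness of unitary frames and existence of a maximum -/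

theorem ContinuousOn.sesqForm {X : Type*} [TopologicalSpace X] {m : ℕ} {s : Set X}
    {A : X → Matrix (Fin m) (Fin m) ℂ} {c c' : X → Cn m}
    (hA : ∀ i j, ContinuousOn (fun p => A p i j) s) (hc : ContinuousOn c s)
    (hc' : ContinuousOn c' s) :
    ContinuousOn (fun p => sesqForm (A p) (c p) (c' p)) s := by
  have hp : ∀ {c : X → Cn m}, ContinuousOn c s → ∀ i, ContinuousOn (fun p => c p i) s :=
    fun hc i => (EuclideanSpace.proj (𝕜 := ℂ) i : Cn m →L[ℂ] ℂ).continuous.comp_continuousOn hc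
  refine continuousOn_finsetSum _ fun i _ => continuousOn_finsetSum _ fun j _ => ?_
  exact ((hp hc i).mul (Complex.continuous_conj.comp_continuousOn (hp hc' j))).mul (hA i j)

theorem sesqForm_smul_smul {m : ℕ} (A : Matrix (Fin m) (Fin m) ℂ) (r : ℝ) (c : Cn m) :
    sesqForm A ((r : ℂ) • c : Cn m) ((r : ℂ) • c : Cn m) = (r ^ 2 : ℝ) * sesqForm A c c := by
  simp only [sesqForm, Finset.mul_sum]
  refine Finset.sum_congr rfl fun i _ => Finset.sum_congr rfl fun j _ => ?_
  simp only [PiLp.smul_apply, smul_eq_mul, map_mul, Complex.conj_ofReal, Complex.ofReal_pow]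
  ring

/-- The set of unitary frames over a compact set is compact. -/
theorem isCompact_unitary_frames {m l : ℕ} {A : Cn m → Matrix (Fin m) (Fin m) ℂ} {K : Set (Cn m)}
    (hK : IsCompact K) (hA : ∀ i j, ContinuousOn (fun z => A z i j) K)
    (hpos : ∀ z ∈ K, ∀ c : Cn m, c ≠ 0 → 0 < (sesqForm (A z) c c).re) :
    IsCompact {p : Cn m × (Fin l → Cn m) | p.1 ∈ K ∧
      ∀ i j, sesqForm (A p.1) (p.2 i) (p.2 j) = if i = j then 1 else 0} := by
  -- The metric is bounded below on the unit sphere over `K`, hence by homogeneity dominates `ε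
  -- ‖c‖²`. Unitary vectors then satisfy `‖c‖² ≤ 1/ε`, so `‖c‖ ≤ 1/ε + 1`.
  obtain ⟨ε, hε, hmin⟩ : ∃ ε : ℝ, 0 < ε ∧ ∀ p ∈ K ×ˢ Metric.sphere (0 : Cn m) 1,
      ε ≤ (sesqForm (A p.1) p.2 p.2).re := by
    refine (hK.prod (isCompact_sphere (0 : Cn m) 1)).exists_forall_le' ?_ ?_
    · refine Complex.continuous_re.comp_continuousOn (ContinuousOn.sesqForm (fun i j => ?_)
        continuousOn_snd continuousOn_snd)
      exact (hA i j).comp continuousOn_fst fun p hp => hp.1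
    · intro p hp
      refine hpos _ hp.1 _ ?_
      rintro h0
      have := hp.2
      rw [h0] at this
      simp at this
  have hbound : ∀ z ∈ K, ∀ c : Cn m, ε * ‖c‖ ^ 2 ≤ (sesqForm (A z) c c).re := by
    intro z hz c
    by_cases hc : c = 0
    · simp [hc, sesqForm]
    have hc' : ‖c‖ ≠ 0 := norm_ne_zero_iff.2 hc
    have h1 := hmin (z, ((‖c‖⁻¹ : ℝ) : ℂ) • c) ⟨hz, by
      simp [norm_smul, hc']⟩
    simp only [sesqForm_smul_smul, Complex.re_ofReal_mul] at h1
    calc ε * ‖c‖ ^ 2 ≤ (‖c‖⁻¹ ^ 2 * (sesqForm (A z) c c).re) * ‖c‖ ^ 2 := by gcongr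
      _ = (sesqForm (A z) c c).re := by field_simp
  have hclosed : IsClosed {p : Cn m × (Fin l → Cn m) | p.1 ∈ K ∧
      ∀ i j, sesqForm (A p.1) (p.2 i) (p.2 j) = if i = j then 1 else 0} := by
    have hcont : ContinuousOn (fun p : Cn m × (Fin l → Cn m) =>
        (fun i j => sesqForm (A p.1) (p.2 i) (p.2 j) : Fin l → Fin l → ℂ)) (K ×ˢ Set.univ) := by
      refine continuousOn_pi.2 fun i => continuousOn_pi.2 fun j => ?_
      refine ContinuousOn.sesqForm (fun a b => ?_) (by fun_prop) (by fun_prop)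
      exact (hA a b).comp continuousOn_fst fun p hp => hp.1
    have := hcont.preimage_isClosed_of_isClosed (hK.isClosed.prod isClosed_univ)
      (isClosed_singleton (x := fun i j : Fin l => if i = j then (1 : ℂ) else 0))
    convert this using 1
    ext p
    simp [funext_iff]
  refine (hK.prod (isCompact_closedBall (0 : Fin l → Cn m) (1 / ε + 1))).of_isClosed_subset hclosed ?_
  rintro p ⟨hp1, hp2⟩
  refine ⟨hp1, ?_⟩
  rw [mem_closedBall_zero_iff, pi_norm_le_iff_of_nonneg (by positivity)]
  intro i
  have h1 := hbound p.1 hp1 (p.2 i)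
  rw [hp2 i i, if_pos rfl, Complex.one_re] at h1
  have h2 : ‖p.2 i‖ ^ 2 ≤ 1 / ε := by rw [le_div_iff₀ hε]; linarith
  nlinarith [sq_nonneg (‖p.2 i‖ - 1), norm_nonneg (p.2 i)]

theorem HermitianMetric.isUnitary_iff_gram {m : ℕ} {M : Type*} [TopologicalSpace M]
    [ChartedSpace (Cn m) M] (g : HermitianMetric m M) {x : M} {l : ℕ}
    {e : Fin l → T m x} : g.IsUnitary x e ↔ gram (g.inner x) e = 1 := by
  simp only [HermitianMetric.IsUnitary, ← Matrix.ext_iff, gram, of_apply, Matrix.one_apply]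

section Maximum

variable {m n : ℕ} {M N : Type*} [TopologicalSpace M] [ChartedSpace (Cn m) M]
  [IsManifold 𝓘(ℂ, Cn m) ω M]
  [TopologicalSpace N] [ChartedSpace (Cn n) N] [IsManifold 𝓘(ℂ, Cn n) ω N]

/-- In charts, the unitary frames over a compact coordinate neighbourhood form a compact set on
which the function is continuous. The point `x₀` is not required to lie in `U`, so the property
passes to subsets and to finite unions. -/
theorem exists_isMax_near (g : HermitianMetric m M) (h : HermitianMetric n N) {f : M → N}
    (hf : ContMDiff 𝓘(ℂ, Cn m) 𝓘(ℂ, Cn n) ω f) {l : ℕ} (hl : l ≤ m)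
    {Φ : Matrix (Fin l) (Fin l) ℂ → ℝ} (hΦ : Continuous Φ) (x : M) :
    ∃ U ∈ 𝓝 x, ∃ (x₀ : M) (v₀ : Fin l → T m x₀), g.IsUnitary x₀ v₀ ∧
      ∀ y ∈ U, ∀ v : Fin l → T m y, g.IsUnitary y v →
        Φ (gram (pullInner h f y) v) ≤ Φ (gram (pullInner h f x₀) v₀) := by
  have : IsManifold 𝓘(ℂ, Cn m) 1 M := IsManifold.of_le (n := ω) le_top
  have : IsManifold 𝓘(ℂ, Cn n) 1 N := IsManifold.of_le (n := ω) le_top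
  set φ := chartAt (Cn m) x with hφdef
  set ψ := chartAt (Cn n) (f x) with hψdef
  have hφ : φ ∈ atlas (Cn m) M := chart_mem_atlas _ _
  have hψ : ψ ∈ atlas (Cn n) N := chart_mem_atlas _ _
  have hx : x ∈ φ.source := mem_chart_source _ _
  have hz : φ x ∈ φ.target := φ.map_source hx
  set F : Cn m → Cn n := fun w => ψ (f (φ.symm w)) with hFdef
  have hnhds : φ.target ∩ {w | f (φ.symm w) ∈ ψ.source} ∈ 𝓝 (φ x) := by
    refine inter_mem (φ.open_target.mem_nhds hz) ?_
    have hcont : ContinuousAt (fun w => f (φ.symm w)) (φ x) :=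
      (hf.continuous.continuousAt).comp (φ.symm.continuousAt hz)
    refine hcont.preimage_mem_nhds (ψ.open_source.mem_nhds ?_)
    rw [φ.left_inv hx]
    exact mem_chart_source _ _
  obtain ⟨K, hKn, hKsub, hK⟩ := local_compact_nhds hnhds
  have hFa : ∀ w ∈ K, AnalyticAt ℂ F w := fun w hw =>
    analyticAt_chart_expr hf hφ hψ (hKsub hw).1 (hKsub hw).2
  have hAc : ∀ i j, ContinuousOn (fun z => g.matrix φ z i j) K := fun i j w hw =>
    (g.contDiffAt_matrix hφ (hKsub hw).1 i j).continuousAt.continuousWithinAt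
  have hgK : ∀ w ∈ K, ∀ u v : T m (φ.symm w), g.inner (φ.symm w) u v
      = sesqForm (g.matrix φ w) (coords φ (φ.symm w) u) (coords φ (φ.symm w) v) := by
    intro w hw u v
    rw [g.inner_eq_sesqForm hφ (φ.map_target (hKsub hw).1), φ.right_inv (hKsub hw).1]
  have hcK : ∀ w ∈ K, ∀ c : Cn m, ∃ u : T m (φ.symm w), coords φ (φ.symm w) u = c :=
    fun w hw c => (coords_bijective hφ (φ.map_target (hKsub hw).1)).2 c
  set HH : Cn m × (Fin l → Cn m) → Matrix (Fin l) (Fin l) ℂ := fun p => Matrix.of fun i j =>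
    sesqForm (h.matrix ψ (F p.1)) (fderiv ℂ F p.1 (p.2 i)) (fderiv ℂ F p.1 (p.2 j)) with hHH
  have hHK : ∀ w ∈ K, ∀ v : Fin l → T m (φ.symm w), gram (pullInner h f (φ.symm w)) v
      = HH (w, fun i => coords φ (φ.symm w) (v i)) := by
    intro w hw v
    ext i j
    simp only [gram, of_apply, pullInner_apply, hHH]
    rw [h.inner_eq_sesqForm hψ (hKsub hw).2, coords_tmap hf hφ hψ (φ.map_target (hKsub hw).1)
      (hKsub hw).2, coords_tmap hf hφ hψ (φ.map_target (hKsub hw).1) (hKsub hw).2,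
      φ.right_inv (hKsub hw).1]
  have hcomp := isCompact_unitary_frames (l := l) hK hAc (fun w hw c hc => by
    obtain ⟨u, rfl⟩ := hcK w hw c
    rw [← hgK w hw]
    refine g.pos _ _ ?_
    rintro rfl
    exact hc (map_zero _))
  set S := {p : Cn m × (Fin l → Cn m) | p.1 ∈ K ∧
      ∀ i j, sesqForm (g.matrix φ p.1) (p.2 i) (p.2 j) = if i = j then 1 else 0} with hS
  have hmem : ∀ w ∈ K, ∀ v : Fin l → T m (φ.symm w), g.IsUnitary (φ.symm w) v ↔
      (w, fun i => coords φ (φ.symm w) (v i)) ∈ S := by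
    intro w hw v
    simp only [HermitianMetric.IsUnitary, hS, Set.mem_ofPred_eq, hw, true_and, hgK w hw]
  have hne : S.Nonempty := by
    have hxK := mem_of_mem_nhds hKn
    obtain ⟨u, hu, -⟩ := g.exists_isUnitary_span hl (fun _ => (0 : T m (φ.symm (φ x))))
    exact ⟨_, (hmem _ hxK u).1 hu⟩
  have hHc : ContinuousOn (fun p => Φ (HH p)) S := by
    refine hΦ.comp_continuousOn (continuousOn_pi.2 fun i => continuousOn_pi.2 fun j => ?_)
    have hfst : ContinuousOn (Prod.fst : Cn m × (Fin l → Cn m) → Cn m) S := continuousOn_fst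
    have hd : ContinuousOn (fun p : Cn m × (Fin l → Cn m) => fderiv ℂ F p.1) S :=
      ContinuousOn.comp (t := K) (fun w hw => (hFa w hw).fderiv.continuousAt.continuousWithinAt)
        hfst fun p hp => hp.1
    refine ContinuousOn.sesqForm (fun a b => ?_) (hd.clm_apply (by fun_prop))
      (hd.clm_apply (by fun_prop))
    refine ContinuousOn.comp (t := K) (f := Prod.fst) (g := fun w => h.matrix ψ (F w) a b)
      (fun w hw => ?_) hfst fun p hp => hp.1
    have h1 : ContinuousAt (fun w => h.matrix ψ w a b) (F w) :=
      (h.contDiffAt_matrix hψ (ψ.map_source (hKsub hw).2) a b).continuousAt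
    exact (ContinuousAt.comp (f := F) (x := w) h1 (hFa w hw).continuousAt).continuousWithinAt
  obtain ⟨p, hpS, hpmax⟩ := hcomp.exists_isMaxOn hne hHc
  choose v₀ hv₀ using fun i => hcK p.1 hpS.1 (p.2 i)
  have hp : (p.1, fun i => coords φ (φ.symm p.1) (v₀ i)) = p := by simp [hv₀]
  refine ⟨φ.source ∩ φ ⁻¹' K, inter_mem (φ.open_source.mem_nhds hx)
    ((φ.continuousAt hx).preimage_mem_nhds hKn), φ.symm p.1, v₀, ?_, ?_⟩
  · rw [hmem p.1 hpS.1, hp]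
    exact hpS
  · rintro y ⟨hy, hyK⟩ v hv
    obtain ⟨w, hw, rfl⟩ : ∃ w ∈ K, φ.symm w = y := ⟨φ y, hyK, φ.left_inv hy⟩
    rw [hHK w hw, hHK p.1 hpS.1, hp]
    exact hpmax ((hmem w hw v).1 hv)

/-- On a compact manifold, a continuous function of the Gram matrix of `f*h` attains its maximum
over all unitary families of `l` vectors. -/
theorem exists_isMax [CompactSpace M] (g : HermitianMetric m M) (h : HermitianMetric n N)
    {f : M → N} (hf : ContMDiff 𝓘(ℂ, Cn m) 𝓘(ℂ, Cn n) ω f) {l : ℕ} (hl : l ≤ m)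
    {Φ : Matrix (Fin l) (Fin l) ℂ → ℝ} (hΦ : Continuous Φ) (x : M) :
    ∃ (x₀ : M) (v₀ : Fin l → T m x₀), g.IsUnitary x₀ v₀ ∧
      ∀ (y : M) (v : Fin l → T m y), g.IsUnitary y v →
        Φ (gram (pullInner h f y) v) ≤ Φ (gram (pullInner h f x₀) v₀) := by
  -- Compactness globalises the local maxima: over a union, the larger of the two competing values
  -- bounds both. The point `x` serves only to supply a frame for the empty set.
  have key := (isCompact_univ (X := M)).induction_on (p := fun U => ∃ (x₀ : M)
      (v₀ : Fin l → T m x₀), g.IsUnitary x₀ v₀ ∧ ∀ y ∈ U, ∀ v : Fin l → T m y, g.IsUnitary y v →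
        Φ (gram (pullInner h f y) v) ≤ Φ (gram (pullInner h f x₀) v₀)) ?_ ?_ ?_ ?_
  · obtain ⟨x₀, v₀, h1, h2⟩ := key
    exact ⟨x₀, v₀, h1, fun y => h2 y trivial⟩
  · obtain ⟨u, hu, -⟩ := g.exists_isUnitary_span hl (fun _ => (0 : T m x))
    exact ⟨x, u, hu, fun y hy => hy.elim⟩
  · rintro s t hst ⟨x₀, v₀, h1, h2⟩
    exact ⟨x₀, v₀, h1, fun y hy => h2 y (hst hy)⟩
  · rintro s t ⟨x₁, v₁, h1, h2⟩ ⟨x₂, v₂, h3, h4⟩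
    rcases le_total (Φ (gram (pullInner h f x₁) v₁)) (Φ (gram (pullInner h f x₂) v₂)) with hle | hle
    · exact ⟨x₂, v₂, h3, fun y hy v hv => hy.elim (fun hy => (h2 y hy v hv).trans hle)
        fun hy => h4 y hy v hv⟩
    · exact ⟨x₁, v₁, h1, fun y hy v hv => hy.elim (fun hy => h2 y hy v hv)
        fun hy => (h4 y hy v hv).trans hle⟩
  · intro y _
    obtain ⟨U, hU, hmax⟩ := exists_isMax_near g h hf hl hΦ y
    exact ⟨U, mem_nhdsWithin_of_mem_nhds hU, hmax⟩

end Maximum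

/-! ### Scaling of the curvature and the scalar curvature in a unitary frame -/

section Chern

variable {m : ℕ} {M : Type*} [TopologicalSpace M] [ChartedSpace (Cn m) M]

theorem HermitianMetric.chern_smul (g : HermitianMetric m M) (x : M) (a a' b b' : ℝ)
    (u v w y : T m x) :
    g.chern x ((a : ℂ) • u) ((a' : ℂ) • v) ((b : ℂ) • w) ((b' : ℂ) • y)
      = (a * a' * b * b' : ℝ) * g.chern x u v w y := by
  have hc : ∀ (c : ℝ) (u : T m x) (i : Fin m), comp x ((c : ℂ) • u) i = c * comp x u i :=
    fun c u i => by
      have := map_smul (coords (chartAt (Cn m) x) x) (c : ℂ) u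
      exact congrArg (fun w : Cn m => w i) this
  simp only [HermitianMetric.chern, hc, Finset.mul_sum, map_mul, Complex.conj_ofReal]
  refine Finset.sum_congr rfl fun i _ => Finset.sum_congr rfl fun j _ =>
    Finset.sum_congr rfl fun k _ => Finset.sum_congr rfl fun l _ => ?_
  push_cast
  ring

/-- If the rows of `E` are the components of a unitary basis, unitarity reads `E A Eᴴ = 1`. For
square matrices this rearranges to `A (Eᴴ E) = 1`. -/
theorem HermitianMetric.inv_eq_sum [IsManifold 𝓘(ℂ, Cn m) 1 M] (g : HermitianMetric m M) {x : M}
    {u : Fin m → T m x} (hu : g.IsUnitary x u) (i j : Fin m) :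
    g.inv (chartAt (Cn m) x) (chartAt (Cn m) x x) i j
      = ∑ a, comp x (u a) i * starRingEnd ℂ (comp x (u a) j) := by
  set A := g.matrix (chartAt (Cn m) x) (chartAt (Cn m) x x) with hA
  let E : Matrix (Fin m) (Fin m) ℂ := Matrix.of fun a i => comp x (u a) i
  have h1 : E * (A * Eᴴ) = 1 := by
    ext a b
    have h2 := hu a b
    rw [g.inner_eq_sesqForm (chart_mem_atlas _ x) (mem_chart_source _ x), sesqForm_eq] at h2
    rw [Matrix.one_apply, ← h2]
    rfl
  have h2 : A * (Eᴴ * E) = 1 := by rw [← Matrix.mul_assoc]; exact mul_eq_one_comm.1 h1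
  rw [HermitianMetric.inv, ← hA, inv_eq_right_inv h2, Matrix.mul_apply]
  refine Finset.sum_congr rfl fun a _ => ?_
  rw [mul_comm]; rfl

/-- This makes (a) the case `l = m` of the determinant estimate. -/
theorem HermitianMetric.chernScalar_eq_lScalar [IsManifold 𝓘(ℂ, Cn m) 1 M]
    (g : HermitianMetric m M) {x : M} {u : Fin m → T m x} (hu : g.IsUnitary x u) :
    g.chernScalar x = g.lScalar x u := by
  simp only [HermitianMetric.chernScalar, HermitianMetric.lScalar, ← Complex.re_sum]
  congr 1
  simp only [HermitianMetric.chern]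
  conv_rhs => rw [sum_sum_comm_sum_sum]
  refine Finset.sum_congr rfl fun i _ => Finset.sum_congr rfl fun j _ => ?_
  conv_rhs => rw [sum_sum_comm_sum_sum]
  refine Finset.sum_congr rfl fun k _ => Finset.sum_congr rfl fun l _ => ?_
  rw [g.inv_eq_sum hu, g.inv_eq_sum hu]
  simp only [Finset.sum_mul, Finset.mul_sum]
  rw [Finset.sum_comm]
  refine Finset.sum_congr rfl fun a _ => Finset.sum_congr rfl fun b _ => ?_
  ring

end Chern

/-! ### Curvature inequalities at a maximum -/

section MaximumPrinciple

variable {m n : ℕ} {M N : Type*} [TopologicalSpace M] [ChartedSpace (Cn m) M]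
  [IsManifold 𝓘(ℂ, Cn m) ω M]
  [TopologicalSpace N] [ChartedSpace (Cn n) N] [IsManifold 𝓘(ℂ, Cn n) ω N]
  {g : HermitianMetric m M} {h : HermitianMetric n N} {f : M → N} {l : ℕ}

/-- The maximum principle is applied to `det H' - det G` along the disc, where `H'` is the
`f*h`-Gram matrix rescaled to be the identity at `x`. This difference is `0` at the centre and
nonpositive nearby, so no logarithm or quotient is needed. -/
theorem sum_chern_le_of_isMax_det (hf : ContMDiff 𝓘(ℂ, Cn m) 𝓘(ℂ, Cn n) ω f) (hl : l ≤ m) {x : M}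
    {e : Fin l → T m x} (he : g.IsUnitary x e) {r : Fin l → ℝ} {E : Fin l → T n (f x)}
    (hr : ∀ i, 0 < r i) (hE : ∀ i, E i = (r i : ℂ) • tmap f x (e i)) (hEu : h.IsUnitary (f x) E)
    (hmax : ∀ (y : M) (u : Fin l → T m y), g.IsUnitary y u →
      (gram (pullInner h f y) u).det.re ≤ (∏ i, r i ^ 2)⁻¹) (v : T m x) :
    ∑ i, (g.chern x v v (e i) (e i)).re
      ≤ ∑ i, (h.chern (f x) (tmap f x v) (tmap f x v) (E i) (E i)).re := by
  obtain ⟨G, H, s, hcurve, hG, hH⟩ := exists_frame_curve g h hf x e v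
  set H' : ℂ → Matrix (Fin l) (Fin l) ℂ := fun t =>
    diagonal (fun i => (r i : ℂ)) * H t * diagonal (fun i => (r i : ℂ)) with hH'
  set s' : Fin l → T n (f x) := fun i => (r i : ℂ) • s i with hs'
  have hr0 : 0 < ∏ i, r i ^ 2 := Finset.prod_pos fun i _ => pow_pos (hr i) 2
  have hdet' : ∀ t, (H' t).det.re = (∏ i, r i ^ 2) * (H t).det.re := fun t => by
    have : (H' t).det = ((∏ i, r i ^ 2 : ℝ) : ℂ) * (H t).det := by
      rw [hH', det_mul, det_mul, det_diagonal, Finset.prod_pow]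
      push_cast
      ring
    rw [this, Complex.re_ofReal_mul]
  set B : Matrix (Fin l) (Fin l) ℂ := Matrix.of fun i j => h.inner (f x) (s' i) (E j) with hB
  have hH'jet : ∀ i j, HasJet (fun t => H' t i j) (if i = j then 1 else 0) (B i j) (Bᴴ i j)
      ((Matrix.of fun i j => h.inner (f x) (s' i) (s' j)
        - h.chern (f x) (tmap f x v) (tmap f x v) (E i) (E j)) i j) := by
    intro i j
    have hc : ((r i : ℂ) * r j) * h.chern (f x) (tmap f x v) (tmap f x v) (tmap f x (e i))
        (tmap f x (e j)) = h.chern (f x) (tmap f x v) (tmap f x v) (E i) (E j) := by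
      have := h.chern_smul (f x) 1 1 (r i) (r j) (tmap f x v) (tmap f x v) (tmap f x (e i))
        (tmap f x (e j))
      rw [hE, hE]
      simpa using this.symm
    refine (((hH i j).const_mul ((r i : ℂ) * r j)).congr (Eventually.of_forall fun t => ?_)).cast
      ?_ ?_ ?_ ?_
    · simp only [hH', mul_diagonal, diagonal_mul]
      ring
    · rw [← hEu i j, hE, hE, pullInner_apply]
      simp only [map_smul, map_smulₛₗ, LinearMap.smul_apply, smul_eq_mul,
        Complex.conj_ofReal]
      ring
    · simp only [hB, of_apply, hs', hE, map_smul, map_smulₛₗ, LinearMap.smul_apply, smul_eq_mul,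
        Complex.conj_ofReal]
      ring
    · rw [conjTranspose_apply, ← starRingEnd_apply, hB, of_apply, h.conj_symm]
      simp only [hs', hE, map_smul, map_smulₛₗ, LinearMap.smul_apply, smul_eq_mul,
        Complex.conj_ofReal]
      ring
    · rw [of_apply, mul_sub, hc]
      simp only [hs', map_smul, map_smulₛₗ, LinearMap.smul_apply, smul_eq_mul,
        Complex.conj_ofReal]
      ring
  have hGjet : ∀ i j, HasJet (fun t => G t i j) (if i = j then 1 else 0)
      ((0 : Matrix (Fin l) (Fin l) ℂ) i j) ((0 : Matrix (Fin l) (Fin l) ℂ) i j)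
      ((Matrix.of fun i j => -g.chern x v v (e i) (e j)) i j) := fun i j =>
    (hG i j).cast (he i j) rfl rfl rfl
  have hle := ((HasJet.det hH'jet).sub (HasJet.det hGjet)).re_nonpos (by
    filter_upwards [hcurve] with t ht
    obtain ⟨y, V, hGt, hHt⟩ := ht
    obtain ⟨u, hu, C, hC⟩ := g.exists_isUnitary_span hl V
    have h1 := gram_det_re_le hC (g.isUnitary_iff_gram.1 hu) (hmax y u hu)
    rw [← hGt, ← hHt] at h1
    rw [Complex.sub_re, hdet', sub_self, Complex.zero_re, sub_nonpos]
    calc (∏ i, r i ^ 2) * (H t).det.re ≤ (∏ i, r i ^ 2) * ((∏ i, r i ^ 2)⁻¹ * (G t).det.re) := by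
          gcongr
      _ = (G t).det.re := by field_simp)
  have e1 : (B.trace * Bᴴ.trace).re = Complex.normSq B.trace := by
    rw [trace_conjTranspose, ← starRingEnd_apply, Complex.mul_conj, Complex.ofReal_re]
  have e2 : (B * Bᴴ).trace.re = ∑ i, ∑ j, Complex.normSq (h.inner (f x) (s' i) (E j)) := by
    simp only [Matrix.trace, Matrix.diag_apply, Matrix.mul_apply, Complex.re_sum,
      conjTranspose_apply, ← starRingEnd_apply, Complex.mul_conj, Complex.ofReal_re]
    rfl
  -- The derivative terms contribute `|tr B|² + ∑ |s'ᵢ|² - tr (B Bᴴ)`, which is nonnegative by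
  -- Bessel, so they can be dropped.
  have e3 : ∑ i, ∑ j, Complex.normSq (h.inner (f x) (s' i) (E j))
      ≤ ∑ i, (h.inner (f x) (s' i) (s' i)).re :=
    Finset.sum_le_sum fun i _ => h.sum_normSq_inner_le hEu (s' i)
  have e4 := Complex.normSq_nonneg B.trace
  rw [Complex.sub_re, Complex.sub_re, Complex.add_re, e1, e2] at hle
  simp only [Matrix.trace, Matrix.diag_apply, of_apply, Complex.re_sum, Complex.sub_re,
    Complex.neg_re, Finset.sum_sub_distrib, Finset.sum_neg_distrib, Matrix.zero_apply,
    Finset.sum_const_zero, mul_zero, add_zero, sub_zero] at hle e4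
  linarith

/-- The maximum principle is applied to `tr (H (2 - G))`, which equals `∑ μᵢ` at the centre. Its
mixed coefficient has real part `∑ μᵢ R^g + ∑ |sᵢ|² - ∑ R^h`, and the middle sum is nonnegative. The
first derivatives of `G` vanish, so no cross terms occur. -/
theorem sum_mul_chern_le_of_isMax_trace (hf : ContMDiff 𝓘(ℂ, Cn m) 𝓘(ℂ, Cn n) ω f) (hl : l ≤ m)
    {x : M} {e : Fin l → T m x} (he : g.IsUnitary x e) {μ : Fin l → ℝ}
    (hμ : gram (pullInner h f x) e = diagonal fun i => (μ i : ℂ))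
    (hmax : ∀ (y : M) (u : Fin l → T m y), g.IsUnitary y u →
      (gram (pullInner h f y) u).trace.re ≤ (gram (pullInner h f x) e).trace.re) (v : T m x) :
    ∑ i, μ i * (g.chern x v v (e i) (e i)).re
      ≤ ∑ i, (h.chern (f x) (tmap f x v) (tmap f x v) (tmap f x (e i)) (tmap f x (e i))).re := by
  obtain ⟨G, H, s, hcurve, hG, hH⟩ := exists_frame_curve g h hf x e v
  have hμ' : ∀ i j, pullInner h f x (e i) (e j) = if i = j then (μ i : ℂ) else 0 := fun i j => by
    exact (congrFun (congrFun hμ i) j).trans (diagonal_apply ..)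
  have key := HasJet.sum Finset.univ fun i _ => HasJet.sum Finset.univ fun j _ =>
    (hH i j).mul ((HasJet.const (if j = i then 2 else 0)).sub (hG j i))
  have hle := key.re_nonpos (by
    filter_upwards [hcurve] with t ht
    obtain ⟨y, V, hGt, hHt⟩ := ht
    obtain ⟨u, hu, C, hC⟩ := g.exists_isUnitary_span hl V
    have h1 := (gram_trace_re_le (re_pullInner_self_nonneg h f y) hC
      (g.isUnitary_iff_gram.1 hu)).trans (hmax y u hu)
    rw [← hGt, ← hHt] at h1
    refine Eq.trans_le ?_ (h1.trans_eq ?_)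
    · simp only [Matrix.trace, Matrix.diag_apply, Matrix.mul_apply, Matrix.sub_apply]
      rfl
    · congr 1
      simp only [Matrix.trace, Matrix.diag_apply, gram, of_apply, he _ _, hμ']
      refine Finset.sum_congr rfl fun i _ => ?_
      rw [Finset.sum_eq_single i (fun j _ hj => by simp [hj.symm]) (by simp)]
      norm_num)
  have hd : ∀ i, (∑ j, (pullInner h f x (e i) (e j) * (0 - -g.chern x v v (e j) (e i))
      + h.inner (f x) (s i) (tmap f x (e j)) * (0 - 0)
      + h.inner (f x) (tmap f x (e i)) (s j) * (0 - 0)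
      + (h.inner (f x) (s i) (s j) - h.chern (f x) (tmap f x v) (tmap f x v) (tmap f x (e i))
          (tmap f x (e j))) * ((if j = i then 2 else 0) - g.inner x (e j) (e i))))
      = μ i * g.chern x v v (e i) (e i) + h.inner (f x) (s i) (s i)
        - h.chern (f x) (tmap f x v) (tmap f x v) (tmap f x (e i)) (tmap f x (e i)) := by
    intro i
    rw [Finset.sum_eq_single i (fun j _ hj => by
      rw [he j i, hμ' i j, if_neg hj, if_neg hj.symm, if_neg hj]; ring) (by simp)]
    rw [he i i, hμ' i i, if_pos rfl, if_pos rfl, if_pos rfl]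
    ring
  rw [Finset.sum_congr rfl fun i _ => hd i] at hle
  simp only [Complex.re_sum, Complex.sub_re, Complex.add_re, Complex.re_ofReal_mul,
    Finset.sum_sub_distrib, Finset.sum_add_distrib] at hle
  have hpos : 0 ≤ ∑ i, (h.inner (f x) (s i) (s i)).re :=
    Finset.sum_nonneg fun i _ => h.re_inner_self_nonneg _
  linarith

end MaximumPrinciple

/-! ### The Schwarz estimates -/

theorem sum_extend_castLE {V R : Type*} [Zero V] [AddCommMonoid R] {l n : ℕ} (hl : l ≤ n)
    (v : Fin l → V) (F : V → R) (hF : F 0 = 0) :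
    ∑ i : Fin n, F (if hi : (i : ℕ) < l then v ⟨i, hi⟩ else 0) = ∑ i, F (v i) := by
  symm
  refine Finset.sum_of_injOn (Fin.castLE hl) (Fin.castLE_injective hl).injOn (by simp) ?_ ?_
  · intro j _ hj
    rw [dif_neg, hF]
    intro hlt
    exact hj ⟨⟨j, hlt⟩, by simp, by ext; simp⟩
  · intro i _
    simp

theorem prod_le_of_sum_le {l : ℕ} (hl : 1 ≤ l) {μ : Fin l → ℝ} (hμ : ∀ i, 0 ≤ μ i) {c : ℝ}
    (hs : ∑ i, μ i ≤ c) : ∏ i, μ i ≤ (c / l) ^ l := by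
  have hl0 : (0 : ℝ) < l := by exact_mod_cast hl
  have h := Real.geom_mean_le_arith_mean Finset.univ (fun _ => 1) μ (by simp)
    (by simpa using Nat.pos_of_ne_zero (by omega))
    (fun i _ => hμ i)
  simp only [Real.rpow_one, one_mul, Finset.sum_const, Finset.card_univ, Fintype.card_fin,
    nsmul_eq_mul, mul_one] at h
  have h0 : 0 ≤ ∏ i, μ i := Finset.prod_nonneg fun i _ => hμ i
  calc ∏ i, μ i = ((∏ i, μ i) ^ ((l : ℝ)⁻¹)) ^ l :=
        (Real.rpow_inv_natCast_pow h0 (by omega)).symm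
    _ ≤ ((∑ i, μ i) / l) ^ l := by gcongr
    _ ≤ (c / l) ^ l := by
        have := Finset.sum_nonneg fun i (_ : i ∈ Finset.univ) => hμ i
        gcongr

section DiagonalPullback

variable {m n : ℕ} {M N : Type*} [TopologicalSpace M] [ChartedSpace (Cn m) M]
  [TopologicalSpace N] [ChartedSpace (Cn n) N] {h : HermitianMetric n N} {f : M → N} {l : ℕ}

theorem diagonal_pullInner {x : M} {e : Fin l → T m x} {μ : Fin l → ℝ}
    (hμ : gram (pullInner h f x) e = diagonal fun i => (μ i : ℂ)) (i j : Fin l) :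
    h.inner (f x) (tmap f x (e i)) (tmap f x (e j)) = if i = j then (μ i : ℂ) else 0 :=
  (congrFun (congrFun hμ i) j).trans (diagonal_apply ..)

theorem diagonal_pullInner_nonneg {x : M} {e : Fin l → T m x} {μ : Fin l → ℝ}
    (hμ : gram (pullInner h f x) e = diagonal fun i => (μ i : ℂ)) (i : Fin l) : 0 ≤ μ i := by
  have h1 := h.re_inner_self_nonneg (tmap f x (e i))
  rwa [diagonal_pullInner hμ, if_pos rfl, Complex.ofReal_re] at h1

end DiagonalPullback

section SchwarzLemma

variable {m n : ℕ} {M N : Type*} [TopologicalSpace M] [ChartedSpace (Cn m) M]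
  [IsManifold 𝓘(ℂ, Cn m) ω M] [CompactSpace M]
  [TopologicalSpace N] [ChartedSpace (Cn n) N] [IsManifold 𝓘(ℂ, Cn n) ω N]
  {g : HermitianMetric m M} {h : HermitianMetric n N} {f : M → N} {l : ℕ} {K κ : ℝ}

/-- Schwarz lemma for the determinant of `f*h` on unitary families of `l` vectors. -/
theorem det_gram_pullInner_le (hf : ContMDiff 𝓘(ℂ, Cn m) 𝓘(ℂ, Cn n) ω f) (hl1 : 1 ≤ l)
    (hl : l ≤ m) (hK : 0 ≤ K) (hκ : 0 < κ)
    (hg : ∀ (x : M) (e : Fin l → T m x), g.IsUnitary x e → -K ≤ g.lScalar x e)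
    (hh : h.FirstRicciLE l (-κ)) {x : M} {u : Fin l → T m x} (hu : g.IsUnitary x u) :
    (gram (pullInner h f x) u).det.re ≤ (K / (l * κ)) ^ l := by
  obtain ⟨x₀, v₀, hv₀, hmax⟩ := exists_isMax g h hf hl
    (Φ := fun A => A.det.re) (Complex.continuous_re.comp (continuous_id.matrix_det)) x
  obtain ⟨e, μ, he, hμ, hdet, -⟩ := exists_gram_diagonal (pullInner_conj_symm h f x₀)
    (g.isUnitary_iff_gram.1 hv₀)
  rw [← g.isUnitary_iff_gram] at he
  have hdet' : (gram (pullInner h f x₀) v₀).det.re = ∏ i, μ i := by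
    rw [← hdet, hμ, det_diagonal, ← Complex.ofReal_prod, Complex.ofReal_re]
  simp only [hdet'] at hmax
  refine (hmax x u hu).trans ?_
  have hμ0 := diagonal_pullInner_nonneg hμ
  -- If some `μᵢ` vanishes, the maximal determinant is `0`. Otherwise the `∂f eᵢ` can be normalised
  -- to a unitary family `E` in `N`.
  by_cases hzero : ∃ i, μ i = 0
  · obtain ⟨i, hi⟩ := hzero
    rw [Finset.prod_eq_zero (Finset.mem_univ i) hi]
    positivity
  push Not at hzero
  have hμpos : ∀ i, 0 < μ i := fun i => lt_of_le_of_ne (hμ0 i) (hzero i).symm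
  set r : Fin l → ℝ := fun i => (√(μ i))⁻¹ with hr
  have hrpos : ∀ i, 0 < r i := fun i => inv_pos.2 (Real.sqrt_pos.2 (hμpos i))
  have hr2 : ∀ i, r i ^ 2 = (μ i)⁻¹ := fun i => by rw [hr, inv_pow, Real.sq_sqrt (hμ0 i)]
  set E : Fin l → T n (f x₀) := fun i => (r i : ℂ) • tmap f x₀ (e i) with hE
  have hEu : h.IsUnitary (f x₀) E := by
    intro i j
    simp only [hE, map_smul, map_smulₛₗ, LinearMap.smul_apply, smul_eq_mul, Complex.conj_ofReal,
      diagonal_pullInner hμ]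
    split_ifs with hij
    · subst hij
      have : r i * (r i * μ i) = 1 := by
        rw [← mul_assoc, ← sq, hr2, inv_mul_cancel₀ (hzero i)]
      exact_mod_cast this
    · simp
  have hineq : ∀ v, ∑ i, (g.chern x₀ v v (e i) (e i)).re
      ≤ h.firstRicci (f x₀) E (tmap f x₀ v) := fun v =>
    sum_chern_le_of_isMax_det hf hl he hrpos (fun i => rfl) hEu (by
      simp only [hr2, Finset.prod_inv_distrib, inv_inv]
      exact hmax) v
  have hric : ∀ i, h.firstRicci (f x₀) E (tmap f x₀ (e i)) ≤ -κ * μ i := fun i => by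
    have h1 := hh (f x₀) (Submodule.span ℂ (Set.range E)) (hEu.finrank_span h) E ⟨hEu, rfl⟩
      (tmap f x₀ (e i)) (by
        have h2 : tmap f x₀ (e i) = ((r i : ℂ)⁻¹) • E i := by
          rw [hE, smul_smul, inv_mul_cancel₀ (by exact_mod_cast (hrpos i).ne'), one_smul]
        rw [h2]
        exact Submodule.smul_mem _ _ (Submodule.subset_span ⟨i, rfl⟩))
    rwa [diagonal_pullInner hμ, if_pos rfl, Complex.ofReal_re] at h1
  -- The inequality at the maximum is summed over the directions `v = eᵢ`: the left side becomes
  -- `S_l`, and the right side a sum of first Ricci curvatures in the span of `E`.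
  have hsum : -K ≤ ∑ i, -κ * μ i :=
    (hg x₀ e he).trans (Finset.sum_le_sum fun i _ => (hineq (e i)).trans (hric i))
  rw [← Finset.mul_sum] at hsum
  have h3 : ∑ i, μ i ≤ K / κ := by rw [le_div_iff₀ hκ]; linarith
  rw [mul_comm, ← div_div]
  exact prod_le_of_sum_le hl1 hμ0 h3

/-- Schwarz lemma for the trace of `f*h` on unitary families of `l` vectors. -/
theorem trace_gram_pullInner_le (hf : ContMDiff 𝓘(ℂ, Cn m) 𝓘(ℂ, Cn n) ω f)
    (hl : l ≤ m) (hmn : m ≤ n) (hK : 0 ≤ K) (hκ : 0 < κ)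
    (hg : g.SecondRicciGE l (-K)) (hh : h.RealBisectionalLE (-κ)) {x : M} {u : Fin l → T m x}
    (hu : g.IsUnitary x u) :
    (gram (pullInner h f x) u).trace.re ≤ l * K / κ := by
  obtain ⟨x₀, v₀, hv₀, hmax⟩ := exists_isMax g h hf hl
    (Φ := fun A => A.trace.re) (Complex.continuous_re.comp (continuous_id.matrix_trace)) x
  obtain ⟨e, μ, he, hμ, -, htr⟩ := exists_gram_diagonal (pullInner_conj_symm h f x₀)
    (g.isUnitary_iff_gram.1 hv₀)
  rw [← g.isUnitary_iff_gram] at he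
  rw [← htr] at hmax
  have htr' : (gram (pullInner h f x₀) e).trace.re = ∑ i, μ i := by
    rw [hμ, trace_diagonal, ← Complex.ofReal_sum, Complex.ofReal_re]
  refine (hmax x u hu).trans ?_
  have hμ0 := diagonal_pullInner_nonneg hμ
  rw [htr']
  have hineq := sum_mul_chern_le_of_isMax_trace hf hl he hμ hmax
  -- For fixed `k`, summing over the directions `eᵢ` produces the second Ricci curvature at `e_k`,
  -- weighted by `μ_k ≥ 0`.
  have hlower : -K * ∑ k, μ k ≤ ∑ i, ∑ k, μ k * (g.chern x₀ (e i) (e i) (e k) (e k)).re := by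
    rw [Finset.sum_comm, Finset.mul_sum]
    refine Finset.sum_le_sum fun k _ => ?_
    rw [← Finset.mul_sum, mul_comm]
    refine mul_le_mul_of_nonneg_left ?_ (hμ0 k)
    have h1 := hg x₀ (Submodule.span ℂ (Set.range e)) (he.finrank_span g) e ⟨he, rfl⟩ (e k)
      (Submodule.subset_span ⟨k, rfl⟩)
    rwa [he k k, if_pos rfl, Complex.one_re, mul_one] at h1
  have hupper : ∑ i, ∑ k, (h.chern (f x₀) (tmap f x₀ (e i)) (tmap f x₀ (e i)) (tmap f x₀ (e k))
      (tmap f x₀ (e k))).re ≤ -κ * ∑ i, μ i ^ 2 := by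
    -- Real bisectional curvature needs a full frame of `N`. The orthogonal vectors `∂f eᵢ` are
    -- padded by zeros to `n` vectors and written as `√aᵢ bᵢ` with `b` unitary. The nonzero `aᵢ` are
    -- then the nonzero `μᵢ`.
    set w : Fin n → T n (f x₀) := fun i =>
      if hi : (i : ℕ) < l then tmap f x₀ (e ⟨i, hi⟩) else 0 with hw
    have hln := hl.trans hmn
    have horth : ∀ i j, i ≠ j → h.inner (f x₀) (w i) (w j) = 0 := by
      intro i j hij
      simp only [hw]
      split_ifs with h1 h2
      · rw [diagonal_pullInner hμ, if_neg (by simpa [Fin.ext_iff] using hij)]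
      all_goals simp
    obtain ⟨b, hb, hwb⟩ := h.exists_isUnitary_of_orthogonal w horth
    set a : Fin n → ℝ := fun i => (h.inner (f x₀) (w i) (w i)).re with ha
    have ha0 : ∀ i, 0 ≤ a i := fun i => h.re_inner_self_nonneg _
    have hzero : ∀ u y : T n (f x₀), h.chern (f x₀) 0 0 u y = 0 ∧ h.chern (f x₀) u y 0 0 = 0 := by
      intro u y
      have h1 := h.chern_smul (f x₀) 0 0 1 1 0 0 u y
      have h2 := h.chern_smul (f x₀) 1 1 0 0 u y 0 0
      constructor
      · simpa using h1
      · simpa using h2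
    have hsum : ∑ i, ∑ k, (h.chern (f x₀) (tmap f x₀ (e i)) (tmap f x₀ (e i)) (tmap f x₀ (e k))
        (tmap f x₀ (e k))).re = ∑ i, ∑ k, (h.chern (f x₀) (b i) (b i) (b k) (b k)).re * a i * a k := by
      have e1 : ∀ p : T n (f x₀), ∑ k, (h.chern (f x₀) p p (tmap f x₀ (e k)) (tmap f x₀ (e k))).re
          = ∑ k, (h.chern (f x₀) p p (w k) (w k)).re := fun p =>
        (sum_extend_castLE hln (fun k => tmap f x₀ (e k)) (fun q => (h.chern (f x₀) p p q q).re)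
          (by simp [hzero])).symm
      have e2 : ∑ i, ∑ k, (h.chern (f x₀) (tmap f x₀ (e i)) (tmap f x₀ (e i)) (w k) (w k)).re
          = ∑ i, ∑ k, (h.chern (f x₀) (w i) (w i) (w k) (w k)).re :=
        (sum_extend_castLE hln (fun k => tmap f x₀ (e k))
          (fun p => ∑ k, (h.chern (f x₀) p p (w k) (w k)).re) (by simp [hzero])).symm
      simp only [e1, e2]
      refine Finset.sum_congr rfl fun i _ => Finset.sum_congr rfl fun k _ => ?_
      rw [hwb i, hwb k, h.chern_smul, Complex.re_ofReal_mul]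
      have h1 := Real.mul_self_sqrt (ha0 i)
      have h2 := Real.mul_self_sqrt (ha0 k)
      calc _ = (√(a i) * √(a i)) * (√(a k) * √(a k)) * (h.chern (f x₀) (b i) (b i) (b k) (b k)).re := by
            simp only [ha]; ring
        _ = _ := by rw [h1, h2]; ring
    have hsq : ∑ i, a i ^ 2 = ∑ i, μ i ^ 2 := by
      refine (sum_extend_castLE hln (fun k => tmap f x₀ (e k))
        (fun q => (h.inner (f x₀) q q).re ^ 2) (by simp)).trans ?_
      simp [diagonal_pullInner hμ]
    rw [hsum, ← hsq]
    -- The curvature hypothesis requires `a ≠ 0`; for `a = 0` both sides vanish.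
    rcases (Finset.sum_nonneg fun i (_ : i ∈ Finset.univ) => sq_nonneg (a i)).eq_or_lt with h0 | h0
    · have ha' : ∀ i, a i = 0 := fun i => by
        have := (Finset.sum_eq_zero_iff_of_nonneg fun i (_ : i ∈ Finset.univ) => sq_nonneg (a i)).1
          h0.symm i (Finset.mem_univ i)
        exact pow_eq_zero_iff (two_ne_zero) |>.1 this
      simp [ha']
    · have h1 := hh (f x₀) b hb a ha0 h0
      rw [HermitianMetric.realBisectional, one_div, inv_mul_le_iff₀ h0] at h1
      linarith
  have hmain : -K * ∑ k, μ k ≤ -κ * ∑ i, μ i ^ 2 :=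
    (hlower.trans (Finset.sum_le_sum fun i _ => hineq (e i))).trans hupper
  -- By Cauchy–Schwarz, `κ (∑ μᵢ)² ≤ l κ ∑ μᵢ² ≤ l K ∑ μᵢ`. Dividing by `∑ μᵢ`, when it is positive,
  -- gives the bound.
  have hcs : (∑ i, μ i) ^ 2 ≤ l * ∑ i, μ i ^ 2 := by
    simpa using sq_sum_le_card_mul_sum_sq (s := Finset.univ) (f := μ)
  have hs0 : 0 ≤ ∑ i, μ i := Finset.sum_nonneg fun i _ => hμ0 i
  rcases hs0.eq_or_lt with h0 | h0
  · rw [← h0]; positivity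
  · rw [le_div_iff₀ hκ]
    refine le_of_mul_le_mul_right ?_ h0
    nlinarith [Nat.cast_nonneg (α := ℝ) l]

theorem volumeRatio_le (hf : ContMDiff 𝓘(ℂ, Cn m) 𝓘(ℂ, Cn n) ω f) (hm : 1 ≤ m)
    (hK : 0 ≤ K) (hκ : 0 < κ) (hg : ∀ x, -K ≤ g.chernScalar x) (hh : h.FirstRicciLE m (-κ))
    (x : M) : volumeRatio g h f x ≤ (K / (m * κ)) ^ m := by
  have : IsManifold 𝓘(ℂ, Cn m) 1 M := IsManifold.of_le (n := ω) le_top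
  set φ := chartAt (Cn m) x
  obtain ⟨u, hu, C, hC⟩ := g.exists_isUnitary_span le_rfl
    (fun i => coordVec φ (φ x) i)
  have hle := det_gram_pullInner_le hf hm le_rfl hK hκ
    (fun y e he => (hg y).trans_eq (g.chernScalar_eq_lScalar he)) hh hu
  have e1 : pullbackMatrix h f φ (φ x)
      = gram (pullInner h f (φ.symm (φ x))) (fun i => coordVec φ (φ x) i) := rfl
  have e2 : g.matrix φ (φ x) = gram (g.inner (φ.symm (φ x))) (fun i => coordVec φ (φ x) i) := rfl
  have e3 : volumeRatio g h f x = (((pullbackMatrix h f φ (φ x)).det)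
      / (g.matrix φ (φ x)).det).re := rfl
  rw [e3, e1, e2, gram_det_eq _ hC, gram_det_eq _ hC, g.isUnitary_iff_gram.1 hu, det_one, mul_one]
  -- In the degenerate case the quotient is `0 / 0 = 0`, which the nonnegative bound covers.
  by_cases h0 : Complex.normSq C.det = 0
  · rw [h0]
    simp only [Complex.ofReal_zero, div_zero, Complex.zero_re]
    positivity
  · rwa [mul_div_cancel_left₀ _ (by exact_mod_cast h0)]

theorem wedgeMapNorm_sq_le (hf : ContMDiff 𝓘(ℂ, Cn m) 𝓘(ℂ, Cn n) ω f) (hl1 : 1 ≤ l)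
    (hl : l ≤ m) (hK : 0 ≤ K) (hκ : 0 < κ) (hg : g.LScalarGE l (-K))
    (hh : h.FirstRicciLE l (-κ)) (x : M) :
    wedgeMapNorm g h f l x ^ 2 ≤ (K / (l * κ)) ^ l := by
  have hb : 0 ≤ (K / (l * κ)) ^ l := by positivity
  have hle : wedgeMapNorm g h f l x ≤ √((K / (l * κ)) ^ l) := by
    -- A nonnegative bound for every quotient bounds the real supremum, whether or not the set is
    -- empty.
    refine Real.sSup_le ?_ (Real.sqrt_nonneg _)
    rintro r ⟨v, -, rfl⟩
    obtain ⟨u, hu, C, hC⟩ := g.exists_isUnitary_span hl v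
    have hdet := det_gram_pullInner_le hf hl1 hl hK hκ
      (fun y e he => hg y _ (he.finrank_span g) e ⟨he, rfl⟩) hh hu
    have e1 : h.wedgeNorm (f x) (fun i => tmap f x (v i))
        = √(gram (pullInner h f x) v).det.re := rfl
    have e2 : g.wedgeNorm x v = √(gram (g.inner x) v).det.re := rfl
    rw [e1, e2, gram_det_eq _ hC, gram_det_eq _ hC, g.isUnitary_iff_gram.1 hu, det_one, mul_one,
      Complex.re_ofReal_mul, Complex.ofReal_re, Real.sqrt_mul (Complex.normSq_nonneg _)]
    by_cases h0 : Complex.normSq C.det = 0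
    · simp [h0]
    · rw [mul_div_cancel_left₀ _ (Real.sqrt_ne_zero'.2
        (lt_of_le_of_ne (Complex.normSq_nonneg _) (Ne.symm h0)))]
      exact Real.sqrt_le_sqrt hdet
  have h0 : 0 ≤ wedgeMapNorm g h f l x := by
    refine Real.sSup_nonneg ?_
    rintro r ⟨v, -, rfl⟩
    exact div_nonneg (Real.sqrt_nonneg _) (Real.sqrt_nonneg _)
  calc wedgeMapNorm g h f l x ^ 2 ≤ √((K / (l * κ)) ^ l) ^ 2 := by gcongr
    _ = _ := Real.sq_sqrt hb

/-- Since the trace estimate holds on every unitary family, it is enough that `σ_l` is the trace on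
one of them, formed by eigenvectors of `∂f* ∂f`. -/
theorem sigma_le (hf : ContMDiff 𝓘(ℂ, Cn m) 𝓘(ℂ, Cn n) ω f)
    (hl : l ≤ m) (hmn : m ≤ n) (hK : 0 ≤ K) (hκ : 0 < κ)
    (hg : g.SecondRicciGE l (-K)) (hh : h.RealBisectionalLE (-κ)) (x : M) :
    sigma g h f l x ≤ l * K / κ := by
  obtain ⟨u, hu, hs⟩ := exists_isUnitary_sigma g h f hl x
  rw [hs, ← Complex.re_sum]
  exact trace_gram_pullInner_le hf hl hmn hK hκ hg hh hu

end SchwarzLemma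

end HermitianGeometry

end

theorem theorem1p3 {m n : ℕ} {M N : Type*}
    [TopologicalSpace M] [T2Space M] [CompactSpace M]
    [ChartedSpace (HermitianGeometry.Cn m) M]
    [IsManifold 𝓘(ℂ, HermitianGeometry.Cn m) ω M]
    [TopologicalSpace N] [T2Space N]
    [ChartedSpace (HermitianGeometry.Cn n) N]
    [IsManifold 𝓘(ℂ, HermitianGeometry.Cn n) ω N]
    (g : HermitianGeometry.HermitianMetric m M) (h : HermitianGeometry.HermitianMetric n N)
    (f : M → N)
    (hf : ContMDiff 𝓘(ℂ, HermitianGeometry.Cn m) 𝓘(ℂ, HermitianGeometry.Cn n) ω f)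
    (hmn : m ≤ n) :
    (∀ K κ : ℝ, 0 ≤ K → 0 < κ →
      (∀ x, -K ≤ g.chernScalar x) → h.FirstRicciLE m (-κ) →
      ∀ x, HermitianGeometry.volumeRatio g h f x ≤ (K / (m * κ)) ^ m) ∧
    (∀ l : ℕ, 1 ≤ l → l < m → g.IsKahler → ∀ K κ : ℝ, 0 ≤ K → 0 < κ →
      g.LScalarGE l (-K) → h.FirstRicciLE l (-κ) →
      ∀ x, HermitianGeometry.wedgeMapNorm g h f l x ^ 2 ≤ (K / (l * κ)) ^ l) ∧
    (∀ l : ℕ, 1 ≤ l → l ≤ m → ∀ K κ : ℝ, 0 ≤ K → 0 < κ →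
      g.SecondRicciGE l (-K) → h.RealBisectionalLE (-κ) →
      ∀ x, HermitianGeometry.sigma g h f l x ≤ l * K / κ) := by
  refine ⟨fun K κ hK hκ hg hh x => ?_, fun l hl1 hl _ K κ hK hκ hg hh x =>
    HermitianGeometry.wedgeMapNorm_sq_le hf hl1 hl.le hK hκ hg hh x,
    fun l _ hl K κ hK hκ hg hh x =>
    HermitianGeometry.sigma_le hf hl hmn hK hκ hg hh x⟩
  -- For `m = 0` the determinants are empty and both sides equal `1`.
  rcases Nat.eq_zero_or_pos m with rfl | hm
  · simp [HermitianGeometry.volumeRatio]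
  · exact HermitianGeometry.volumeRatio_le hf hm hK hκ hg hh x
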